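/- **Conventions.** Let $M,N\ge 1$, $k=\gcd(M,N)$, $m=M/k$, $n=N/k$. *Paths.* An $m,n$-path is a sequence of $n$ north and $m$ east unit steps from $(a,0)$ to $(a+m,n)$, $a\in\mathbb Z$, that begins with a north step and stays weakly above the line $my=nx$; it is extended to an infinite path by repeating its steps. A path tuple is a $k$-tuple $P=(P^{(0)},\dots,P^{(k-1)})$ of $m,n$-paths, $P^{(i)}$ in sheet $i$. The unit cell of sheet $i$ with lower right corner $(x,y)$ has content $i+My-Nx$; up to translation by $(m,n)$ there is exactly one cell of each content $c\in\mathbb Z$, called cell $c$. Cell $c$ is above $P$ if the north step of the path in its row is to its right, and below $P$ otherwise. A cell below $P$ has a north step if its left boundary is a north step of $P$, and has an east step if its upper boundary is an east step of $P$. *$v,w$-path tuples.* Let $v,w$ be words of lengths $M,N$ in the alphabet $\{0,1,\bullet\}$, and let $|v|$ be the number of $1$'s of $v$. $P$ is a $v,w$-path tuple if, for $0\le i<M$, $v_i=\bullet$, $1$ or $0$ according as cell $i$ is above $P$, has a north step, or is below $P$ without a north step, and, for $0\le i<N$, $w_i=\bullet$, $1$ or $0$ according as cell $i$ is above $P$,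 has an east step, or is below $P$ without an east step. *Statistics.* $\operatorname{area}(P)$ is the number of cells $c\ge M+N$ below $P$. $\operatorname{pdinv}(P)$ is the number of pairs of cells $c<d$ with $c\ge 0$ and $M\le d<c+M$ such that $c$ has a north step in $P$ and $d$ is below $P$. *Operators.* Let $K$ be a field of characteristic $0$ and $t\in K\setminus\{0,1\}$ (for instance an indeterminate, $K=\mathbb Q(t)$), let $\Lambda=K[p_1,p_2,\dots]$ be the ring of symmetric functions over $K$, and $V_\ell=K[y_1,\dots,y_\ell]\otimes\Lambda$. In plethystic notation, $$d_+f=T_1T_2\cdots T_\ell\, f[X+(t-1)y_{\ell+1}]\quad(d_+:V_\ell\to V_{\ell+1}),$$ $$d_-f=-y_\ell\, f[X-(t-1)y_\ell]\sum_{i\ge0}h_i[-X/y_\ell]\Big|_{y_\ell^0}\quad(d_-:V_\ell\to V_{\ell-1}),$$ $$T_if=\frac{(t-1)y_if+(y_{i+1}-ty_i)s_if}{y_{i+1}-y_i},\qquad d_=f=\frac{d_-d_+f-d_+d_-f}{t-1}\quad(d_=:V_\ell\to V_\ell,\ \ell\ge1),$$ where $s_i$ exchanges $y_i$ and $y_{i+1}$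 and $|_{y_\ell^0}$ takes the coefficient of $y_\ell^0$. *Characteristic function.* Let $c_1<\dots<c_r$ be the nonnegative cells with a north step in $P$, of which $c_1,\dots,c_\ell$ are those less than $M$. The partial Schröder path $S$ of $P$ is the lattice path from $(0,\ell)$ to $(r,r)$ with steps $(1,0),(0,1),(1,1)$, staying weakly above $y=x$ and without diagonal steps on $y=x$, such that, for $i<j$, the unit square in column $i$ and row $j$ is below $S$ if $c_j<c_i+M$, contains a diagonal step of $S$ if $c_j=c_i+M$, and is above $S$ if $c_j>c_i+M$. Reading $S$ from right to left, start with $1\in V_0$ and apply $d_+$ for each horizontal, $d_-$ for each vertical and $d_=$ for each diagonal step; the result is $\chi(P)\in V_\ell$. *Generating function.* For $|v|=|w|=\ell$ let $$L(v,w)=\sum_P t^{-\operatorname{pdinv}(P)}q^{\operatorname{area}(P)}\chi(P)\in V_\ell[[q]],$$ the sum over all $v,w$-path tuples $P$. Operators on $V_\ell$ are extended coefficientwise to power series in $q$. **Theorem.** For all words $v,w$ of positive lengths and every $a\ge 0$, only finitely many $v,w$-path tuples have area $a$, so the sum is well defined. For all $M,N\ge1$ and all (possibly empty) words $v,w$ in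 $\{0,1,\bullet\}$ such that in each case both words indexing $L$ have the same number of $1$'s: - (0) $L(\bullet^M,\bullet^N)=1$. - (1) $L(\bullet v,\bullet w)=L(v\bullet,w\bullet)$. - (2) $L(0v,0w)=(1-q)^{-1}d_-L(v1,w1)$ if $|v|=|w|=0$. - (3) $L(0v,0w)=t^{-\ell}d_-L(v1,w1)+qt^{-\ell}L(v0,w0)$ if $\ell=|v|=|w|>0$. - (4) $L(1v,0w)=t^{-\ell}d_=L(v1,w\bullet)$ if $\ell=|v|=|w|-1$. - (5) $L(0v,1w)=L(v\bullet,w1)$. - (6) $L(1v,1w)=d_+L(v\bullet,w\bullet)$. -/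

import Mathlib

noncomputable section

namespace TorusRec

/-! ### Symmetric functions and the Carlsson--Mellit operators -/

/-- The ring `Λ` of symmetric functions over a field `K` of characteristic zero, as the polynomial
ring in the power sums `p_1, p_2, …`; the variable `X k` is `p_k`. -/
abbrev SymFun (K : Type*) [Field K] : Type _ := MvPolynomial ℕ+ K

/-- The complete homogeneous symmetric functions, given by `h_0 = 1` and Newton's identity
`n h_n = ∑_{k=1}^n p_k h_{n-k}`. -/
def hsym (K : Type*) [Field K] : ℕ → SymFun K
  | 0 => 1
  | n + 1 => ((n + 1 : ℕ) : K)⁻¹ •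
      ∑ j : Fin (n + 1), MvPolynomial.X (Nat.succPNat j) * hsym K (n - j)
  decreasing_by omega

/-- `V_ℓ = K[y_1, …, y_ℓ] ⊗ Λ`, as the polynomial ring over `K` in the variables `y_i`
(`Sum.inl i`, with `i` counted from `0`) and `p_k` (`Sum.inr k`). -/
abbrev V (K : Type*) [Field K] (l : ℕ) : Type _ := MvPolynomial (Fin l ⊕ ℕ+) K

section Operators

variable {K : Type*} [Field K]

/-- The variable `y_{i+1}` of `V_ℓ`. -/
def y {l : ℕ} (i : Fin l) : V K l := MvPolynomial.X (Sum.inl i)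

/-- The power sum `p_k` in `V_ℓ`. -/
def p {l : ℕ} (k : ℕ+) : V K l := MvPolynomial.X (Sum.inr k)

/-- `h_i[-X]` in `V_ℓ`: the substitution `p_k ↦ -p_k` in `h_i`. -/
def hneg (l i : ℕ) : V K l := MvPolynomial.aeval (fun k : ℕ+ => -(p k : V K l)) (hsym K i)

/-- The automorphism exchanging the `i`-th and the `(i+1)`-st of the `y`-variables. -/
def swapY {l : ℕ} (i : Fin l) : V K (l + 1) →ₐ[K] V K (l + 1) :=
  MvPolynomial.rename (Sum.map (Equiv.swap i.castSucc i.succ) id)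

theorem y_sub_ne_zero {l : ℕ} (i : Fin l) :
    (y i.succ - y i.castSucc : V K (l + 1)) ≠ 0 := by
  rw [sub_ne_zero]
  intro h
  have h1 := Sum.inl_injective (MvPolynomial.X_injective (R := K) h)
  exact (Fin.castSucc_lt_succ (i := i)).ne h1.symm

theorem dvd_sub_swapY {l : ℕ} (i : Fin l) (f : V K (l + 1)) :
    (y i.succ - y i.castSucc : V K (l + 1)) ∣ f - swapY i f := by
  induction f using MvPolynomial.induction_on with
  | C a => simp [swapY]
  | add f g hf hg =>
    have : f + g - swapY i (f + g) = (f - swapY i f) + (g - swapY i g) := by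
      rw [map_add]; ring
    rw [this]
    exact dvd_add hf hg
  | mul_X f s hf =>
    have h2 : f * MvPolynomial.X s - swapY i (f * MvPolynomial.X s)
        = (f - swapY i f) * MvPolynomial.X s
          + swapY i f * (MvPolynomial.X s - swapY i (MvPolynomial.X s)) := by
      rw [map_mul]; ring
    rw [h2]
    refine dvd_add (Dvd.dvd.mul_right hf _) (Dvd.dvd.mul_left ?_ _)
    rcases s with j | k
    · simp only [swapY, MvPolynomial.rename_X, Sum.map_inl]
      by_cases h3 : j = i.castSucc
      · subst h3
        rw [Equiv.swap_apply_left]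
        exact ⟨-1, by simp [y]⟩
      · by_cases h4 : j = i.succ
        · subst h4
          rw [Equiv.swap_apply_right]
          exact ⟨1, by simp [y]⟩
        · rw [Equiv.swap_apply_of_ne_of_ne h3 h4]
          simp
    · simp [swapY]

/-- The numerator of the operator `T_i`. -/
def heckeNum (t : K) {l : ℕ} (i : Fin l) : V K (l + 1) →ₗ[K] V K (l + 1) :=
  LinearMap.mulLeft K ((t - 1) • y i.castSucc) +
    LinearMap.mulLeft K (y i.succ - t • y i.castSucc) ∘ₗ (swapY i).toLinearMap

theorem dvd_heckeNum (t : K) {l : ℕ} (i : Fin l) (f : V K (l + 1)) :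
    (y i.succ - y i.castSucc : V K (l + 1)) ∣ heckeNum t i f := by
  have h : heckeNum t i f = (y i.succ - y i.castSucc) * swapY i f
      + ((t - 1) • y i.castSucc) * (f - swapY i f) := by
    simp only [heckeNum, LinearMap.add_apply, LinearMap.mulLeft_apply, LinearMap.comp_apply,
      AlgHom.toLinearMap_apply, sub_smul, one_smul]
    ring
  rw [h]
  exact dvd_add (dvd_mul_right _ _) (Dvd.dvd.mul_left (dvd_sub_swapY i f) _)

/-- The operator
`T_i f = ((t - 1) y_i f + (y_{i+1} - t y_i) s_i f) / (y_{i+1} - y_i)`, the exact quotient in the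
domain `V_{ℓ+1}`. -/
def T (t : K) {l : ℕ} (i : Fin l) : V K (l + 1) →ₗ[K] V K (l + 1) where
  toFun f := (dvd_heckeNum t i f).choose
  map_add' f g := by
    apply mul_left_cancel₀ (y_sub_ne_zero (K := K) i)
    rw [mul_add, ← (dvd_heckeNum t i (f + g)).choose_spec, ← (dvd_heckeNum t i f).choose_spec,
      ← (dvd_heckeNum t i g).choose_spec, map_add]
  map_smul' a f := by
    apply mul_left_cancel₀ (y_sub_ne_zero (K := K) i)
    rw [RingHom.id_apply, mul_smul_comm, ← (dvd_heckeNum t i (a • f)).choose_spec,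
      ← (dvd_heckeNum t i f).choose_spec, map_smul]

/-- The substitution `f ↦ f[X + (t - 1) y_{ℓ+1}]`, that is `p_k ↦ p_k + (t^k - 1) y_{ℓ+1}^k`. -/
def plusSubst (t : K) (l : ℕ) : V K l →ₐ[K] V K (l + 1) :=
  MvPolynomial.aeval (Sum.elim (fun i => y i.castSucc)
    (fun k => p k + (t ^ (k : ℕ) - 1) • y (Fin.last l) ^ (k : ℕ)))

/-- `d_+ f = T_1 T_2 ⋯ T_ℓ f[X + (t - 1) y_{ℓ+1}]`. -/
def dPlus (t : K) (l : ℕ) : V K l →ₗ[K] V K (l + 1) :=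
  (((List.finRange l).map (fun i => T t i)).prod : Module.End K (V K (l + 1))) ∘ₗ
    (plusSubst t l).toLinearMap

/-- `y_{ℓ+1}` as a Laurent series over `V_ℓ` in the inverse variable `u = y_{ℓ+1}⁻¹`. -/
def yLast (l : ℕ) : HahnSeries ℤ (V K l) := HahnSeries.single (-1) 1

/-- The substitution `f ↦ f[X - (t - 1) y_{ℓ+1}]` on `V_{ℓ+1}`, that is
`p_k ↦ p_k - (t^k - 1) y_{ℓ+1}^k`, with values in the Laurent series over `V_ℓ` in
`y_{ℓ+1}⁻¹`. -/
def minusSubst (t : K) (l : ℕ) : V K (l + 1) →+* HahnSeries ℤ (V K l) :=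
  MvPolynomial.eval₂Hom (HahnSeries.C.comp MvPolynomial.C) (Sum.elim
    (Fin.lastCases (motive := fun _ => HahnSeries ℤ (V K l)) (yLast l)
      (fun i => HahnSeries.C (y i)))
    (fun k => HahnSeries.C (p k) -
      HahnSeries.C (MvPolynomial.C (t ^ (k : ℕ) - 1)) * yLast l ^ (k : ℕ)))

/-- The series `∑_{i ≥ 0} h_i[-X/y_{ℓ+1}] = ∑_{i ≥ 0} h_i[-X] y_{ℓ+1}^{-i}`
(`h_i` is homogeneous of degree `i`). -/
def hSeries (l : ℕ) : HahnSeries ℤ (V K l) :=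
  HahnSeries.ofPowerSeries ℤ (V K l) (PowerSeries.mk (fun i => hneg l i))

/-- `d_- f` is the coefficient of `y_{ℓ+1}^0` in
`-y_{ℓ+1} f[X - (t - 1) y_{ℓ+1}] ∑_{i ≥ 0} h_i[-X/y_{ℓ+1}]`, for `f` in `V_{ℓ+1}`. -/
def dMinus (t : K) (l : ℕ) : V K (l + 1) →ₗ[K] V K l where
  toFun f := -(yLast l * minusSubst t l f * hSeries l).coeff 0
  map_add' f g := by
    rw [map_add, mul_add, add_mul, HahnSeries.coeff_add, neg_add]
  map_smul' a f := by
    have h : minusSubst t l (a • f) = HahnSeries.C (MvPolynomial.C a) * minusSubst t l f := by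
      rw [MvPolynomial.smul_eq_C_mul, map_mul]
      congr 1
      exact MvPolynomial.eval₂Hom_C _ _ a
    rw [h, RingHom.id_apply, mul_left_comm, mul_assoc, HahnSeries.C_mul_eq_smul,
      HahnSeries.coeff_smul, smul_eq_mul, MvPolynomial.smul_eq_C_mul, mul_neg]

/-- `d_= f = (d_- d_+ f - d_+ d_- f) / (t - 1)` on `V_{ℓ+1}`. -/
def dEq (t : K) (l : ℕ) : V K (l + 1) →ₗ[K] V K (l + 1) :=
  (t - 1)⁻¹ • (dMinus t (l + 1) ∘ₗ dPlus t (l + 1) - dPlus t l ∘ₗ dMinus t l)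

end Operators

/-! ### Path tuples -/

/-- An `m,n`-path: `n` north and `m` east unit steps from `(a, 0)` to `(a + m, n)`, beginning with
a north step and staying weakly above the line `m y = n x`. It is recorded through the infinite
path obtained by repeating its steps: `x j` is the abscissa of the north step from height `j` to
height `j + 1`. At height `j + 1` the path thus runs east from `x j` to `x (j + 1)`, and
`a = x 0`. -/
@[ext]
structure NEPath (m n : ℕ) where
  x : ℤ → ℤ
  mono : Monotone x
  periodic : ∀ j, x (j + n) = x j + m
  above : ∀ j, (n : ℤ) * x j ≤ m * j

/-- A tuple of `k = gcd(M, N)` many `M/k, N/k`-paths, one in each of `k` sheets. -/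
abbrev PathTuple (M N : ℕ) : Type :=
  Fin (M.gcd N) → NEPath (M / M.gcd N) (N / M.gcd N)

/-- The content of the unit cell of sheet `i` with lower right lattice point `(x, y)`. -/
def content (M N : ℕ) (i x y : ℤ) : ℤ := i + M * y - N * x

variable {M N : ℕ}

/-- The cell of content `c` is above `P`: the north step in its row is to its right. (The cells
of content `c` in all bands form one orbit of the translation symmetry of the repeated path.) -/
def Above (P : PathTuple M N) (c : ℤ) : Prop :=
  ∃ (i : Fin (M.gcd N)) (x y : ℤ), content M N (i : ℕ) x y = c ∧ x ≤ (P i).x y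

/-- A cell that is not above `P` is (weakly) below `P`. -/
def Below (P : PathTuple M N) (c : ℤ) : Prop := ¬ Above P c

/-- The contents of the cells with a north step of `P` on their left boundary. In sheet `i`, the
north step in row `y` is the left boundary of the cell with lower right point `(x_y + 1, y)`. -/
def northCells (P : PathTuple M N) : Finset ℤ :=
  Finset.univ.image (fun iy : Fin (M.gcd N) × Fin (N / M.gcd N) =>
    content M N (iy.1 : ℕ) ((P iy.1).x (iy.2 : ℕ) + 1) (iy.2 : ℕ))

/-- The cell of content `c` has a north step in `P`. -/
def HasNorth (P : PathTuple M N) (c : ℤ) : Prop := c ∈ northCells P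

/-- The cell of content `c` has an east step of `P` on its upper boundary. -/
def HasEast (P : PathTuple M N) (c : ℤ) : Prop :=
  ∃ (i : Fin (M.gcd N)) (x y : ℤ), content M N (i : ℕ) x y = c ∧
    (P i).x y ≤ x - 1 ∧ x ≤ (P i).x (y + 1)

/-- The alphabet `{0, 1, •}`. -/
inductive Letter
  | zero
  | one
  | bullet
  deriving DecidableEq

/-- `|v|`, the number of `1`'s in `v`. -/
def ones (v : List Letter) : ℕ := v.count Letter.one

/-- `P` is a `v,w`-path tuple: `v` records the position of the cells `0, …, M-1` with respect to
the north steps, `w` the position of the cells `0, …, N-1` with respect to the east steps. -/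
structure Fits (v w : List Letter) (P : PathTuple v.length w.length) : Prop where
  v_zero : ∀ (i : ℕ) (h : i < v.length), v[i] = Letter.zero ↔ Below P i ∧ ¬ HasNorth P i
  v_one : ∀ (i : ℕ) (h : i < v.length), v[i] = Letter.one ↔ HasNorth P i
  v_bullet : ∀ (i : ℕ) (h : i < v.length), v[i] = Letter.bullet ↔ Above P i
  w_zero : ∀ (i : ℕ) (h : i < w.length), w[i] = Letter.zero ↔ Below P i ∧ ¬ HasEast P i
  w_one : ∀ (i : ℕ) (h : i < w.length), w[i] = Letter.one ↔ HasEast P i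
  w_bullet : ∀ (i : ℕ) (h : i < w.length), w[i] = Letter.bullet ↔ Above P i

/-- The number of cells `c ≥ M + N` below `P` (a finite number). -/
def area (P : PathTuple M N) : ℕ := Set.ncard {c : ℤ | (M : ℤ) + N ≤ c ∧ Below P c}

/-- The number of path diagonal inversions of `P` (a finite number). -/
def pdinv (P : PathTuple M N) : ℕ :=
  Set.ncard {cd : ℤ × ℤ | cd.1 < cd.2 ∧ 0 ≤ cd.1 ∧ (M : ℤ) ≤ cd.2 ∧ cd.2 < cd.1 + M ∧
    HasNorth P cd.1 ∧ Below P cd.2}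

/-! ### The characteristic function -/

/-- Steps of a partial Schröder path. -/
inductive Step
  | horizontal
  | vertical
  | diagonal
  deriving DecidableEq

/-- The number of `c_j` in the list `cs` with `c_j < b`. -/
def countBelow (cs : List ℤ) (b : ℤ) : ℕ := cs.countP (fun c => decide (c < b))

/-- The part of the partial Schröder path that starts at height `h` and lies in the columns
of the entries of the second list (a final segment of `cs`). In the column of `c` exactly the
squares in the rows of the `c_j < c + M` are below the path; so the path climbs to height
`#{j | c_j < c + M}`, and then makes a diagonal step if `c + M` is some `c_j` (then the square in
that row, which is the next row up, holds the diagonal step), and a horizontal step otherwise. -/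
def schroederFrom (M : ℕ) (cs : List ℤ) : ℕ → List ℤ → List Step
  | _, [] => []
  | h, c :: rest =>
    List.replicate (countBelow cs (c + M) - h) Step.vertical ++
      if c + M ∈ cs then
        Step.diagonal :: schroederFrom M cs (countBelow cs (c + M) + 1) rest
      else
        Step.horizontal :: schroederFrom M cs (countBelow cs (c + M)) rest

/-- The partial Schröder path attached to `c_1 < c_2 < ⋯`, from `(0, ℓ)` where `ℓ` is the number of
the `c_j < M`. -/
def schroeder (M : ℕ) (cs : List ℤ) : List Step :=
  schroederFrom M cs (countBelow cs M) cs

/-- The nonnegative contents of cells with north steps in `P`, in increasing order. -/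
def northList (P : PathTuple M N) : List ℤ :=
  ((northCells P).filter (fun c => 0 ≤ c)).sort (fun a b => a ≤ b)

/-- The operators of the steps of a path from `(0, l)` to the diagonal, applied to `1` from right
to left. At a point `(x, y)` of the path one has an element of `V_{y-x}`; the branches with
value `0` do not occur for partial Schröder paths. -/
def evalSteps {K : Type*} [Field K] (t : K) : (l : ℕ) → List Step → V K l
  | 0, [] => 1
  | _ + 1, [] => 0
  | l, Step.vertical :: S => dMinus t l (evalSteps t (l + 1) S)
  | l + 1, Step.horizontal :: S => dPlus t l (evalSteps t l S)
  | 0, Step.horizontal :: _ => 0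
  | l + 1, Step.diagonal :: S => dEq t l (evalSteps t (l + 1) S)
  | 0, Step.diagonal :: _ => 0

/-- The characteristic function of a path tuple with `l` basement north steps, in `V_l`. -/
def chi {K : Type*} [Field K] (t : K) (l : ℕ) (P : PathTuple M N) : V K l :=
  evalSteps t l (schroeder M (northList P))

/-- The generating function `L(v, w) = ∑_P t^{-pdinv P} q^{area P} χ(P)` over the `v,w`-path tuples
`P`, as a formal power series in `q` over `V_l`, where `l = |v| = |w|`. -/
def L {K : Type*} [Field K] (t : K) (l : ℕ) (v w : List Letter) : PowerSeries (V K l) :=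
  PowerSeries.mk (fun a =>
    ∑ᶠ P ∈ {P : PathTuple v.length w.length | Fits v w P ∧ area P = a},
      t ^ (-(pdinv P : ℤ)) • chi t l P)

/-- The `q`-linear extension of a linear operator to formal power series in `q`. -/
def qExt {K : Type*} [Field K] {l l' : ℕ} (d : V K l →ₗ[K] V K l') (F : PowerSeries (V K l)) :
    PowerSeries (V K l') :=
  PowerSeries.mk (fun a => d (PowerSeries.coeff a F))

end TorusRec

end

open TorusRec

noncomputable section

namespace TorusRec

/-! ### Path tuples as invariant sets -/

/-! A path tuple is determined by the set `U` of contents of the cells above it. Adding `N` to a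
content moves one cell to the left, adding `M` one cell up; so these `U` are exactly the cofinite
sets of nonnegative integers closed under adding `M` and `N`, and a cell `c ∉ U` has a north (east)
step iff `c + N ∈ U` (`c + M ∈ U`). Words, area, pdinv and the Schröder path are thus read off from
`U`, and `L` becomes a sum over invariant sets (`L_eq_gen`).

The recursion is the effect of moving `U` down by one and discarding negative elements. Each word
loses its first letter and gains the letter of cell `M` (for `v`) or `N` (for `w`). If `0 ∈ U`, both
new letters are bullets. Otherwise the first letter of either word is `1` exactly when the new
letter of the other is a bullet, so the set is recovered by moving back up. The area drops by one
iff cell `M + N` is below (`IsShift.ncard_areaSet`). If cell `M` is below, pdinv loses the pairs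
`(c, M)`, one for each `1` in the rest of `v` (`IsShift.ncard_pdinvSet`, `ones_map_letter`). The
Schröder path loses a horizontal, vertical or diagonal step, or nothing, according to which of the
cells `0` and `M` have north steps. The case of two first letters `0` splits by whether `M + N` is
in `U`, which gives the two summands in (3).

For (2) the second summand must instead be `q` times the left side. Without ones, the cells below in
`[0, M + N)` generate a set `Z` with periods `M` and `N`, and `U` contains every nonnegative integer
outside `Z`. If `M + N ∉ U`, moving `U ∩ Z` one place down along `Z` keeps the words, pdinv and the
Schröder path and lowers the area by one; it is a bijection onto the whole family (`bijOn_lower`).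
Hence `F = d_- L(v1, w1) + q F`. -/

/-- The cofinite sets of nonnegative integers that are closed under addition of `M` and of `N`:
these are the sets of cells above a path tuple. -/
structure InvariantSet (M N : ℕ) (U : Set ℤ) : Prop where
  nonneg : ∀ c ∈ U, 0 ≤ c
  add_left : ∀ c ∈ U, c + M ∈ U
  add_right : ∀ c ∈ U, c + N ∈ U
  cofinite : ∃ B : ℤ, ∀ c, B ≤ c → c ∈ U

/-- The cells above a path tuple. -/
def aboveSet {M N : ℕ} (P : PathTuple M N) : Set ℤ := {c | Above P c}

theorem NEPath.x_add_mul {m n : ℕ} (p : NEPath m n) (j s : ℤ) :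
    p.x (j + n * s) = p.x j + m * s := by
  induction s using Int.induction_on with
  | zero => simp
  | succ s ih =>
    rw [show j + (n : ℤ) * (s + 1) = (j + n * s) + n by ring, p.periodic, ih]; ring
  | pred s ih =>
    have h := p.periodic (j + n * (-(s : ℤ) - 1))
    rw [show j + (n : ℤ) * (-(s : ℤ) - 1) + n = j + n * (-(s : ℤ)) by ring, ih] at h
    linarith

section

variable {M N : ℕ}

/-- The remainder of `c` modulo `gcd(M, N)` is the sheet; Bézout coefficients, scaled by the
quotient, give the position. -/
theorem exists_content_eq (hM : 0 < M) (c : ℤ) :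
    ∃ (i : Fin (M.gcd N)) (x y : ℤ), content M N (i : ℕ) x y = c := by
  have hk : 0 < M.gcd N := Nat.gcd_pos_of_pos_left _ hM
  have hk' : (0 : ℤ) < (M.gcd N : ℕ) := by exact_mod_cast hk
  have h0 := Int.emod_nonneg c hk'.ne'
  have h1 := Int.emod_lt_of_pos c hk'
  refine ⟨⟨(c % (M.gcd N : ℕ)).toNat, by omega⟩,
    -(c / (M.gcd N : ℕ)) * Nat.gcdB M N, (c / (M.gcd N : ℕ)) * Nat.gcdA M N, ?_⟩
  have h2 := Nat.gcd_eq_gcd_ab M N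
  have h3 := Int.emod_add_mul_ediv c (M.gcd N : ℕ)
  simp only [content, Int.toNat_of_nonneg h0]
  rw [h2] at h3 ⊢
  linear_combination h3

/-- Translation by `(m, n)` preserves contents because `M n = N m`, so the row can be reduced modulo
`n`. -/
theorem exists_content_eq_fin (hM : 0 < M) (hN : 0 < N) (c : ℤ) :
    ∃ (i : Fin (M.gcd N)) (x : ℤ) (y : Fin (N / M.gcd N)),
      content M N (i : ℕ) x (y : ℕ) = c := by
  obtain ⟨i, x, y, h⟩ := exists_content_eq (N := N) hM c
  have hk : 0 < M.gcd N := Nat.gcd_pos_of_pos_left _ hM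
  have hn : 0 < N / M.gcd N := Nat.div_pos (Nat.le_of_dvd hN (Nat.gcd_dvd_right _ _)) hk
  have hn' : (0 : ℤ) < (N / M.gcd N : ℕ) := by exact_mod_cast hn
  have h0 := Int.emod_nonneg y hn'.ne'
  have h1 := Int.emod_lt_of_pos y hn'
  refine ⟨i, x - (M / M.gcd N : ℕ) * (y / (N / M.gcd N : ℕ)),
    ⟨(y % (N / M.gcd N : ℕ)).toNat, by omega⟩, ?_⟩
  have h3 := Int.emod_add_mul_ediv y (N / M.gcd N : ℕ)
  have hM2 : (M : ℤ) = (M.gcd N : ℕ) * (M / M.gcd N : ℕ) := by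
    exact_mod_cast (Nat.mul_div_cancel' (Nat.gcd_dvd_left M N)).symm
  have hN2 : (N : ℤ) = (M.gcd N : ℕ) * (N / M.gcd N : ℕ) := by
    exact_mod_cast (Nat.mul_div_cancel' (Nat.gcd_dvd_right M N)).symm
  rw [← h]
  simp only [content, Int.toNat_of_nonneg h0]
  generalize ((M / M.gcd N : ℕ) : ℤ) = m at *
  generalize ((N / M.gcd N : ℕ) : ℤ) = n at *
  rw [hM2, hN2]
  linear_combination ((M.gcd N : ℕ) : ℤ) * m * h3

/-- The sheet is the content modulo the gcd; after dividing by the gcd, coprimality of `m` and `n`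
leaves only multiples of the translation `(m, n)`. -/
theorem content_inj (hM : 0 < M) {i i' : Fin (M.gcd N)} {x y x' y' : ℤ}
    (h : content M N (i : ℕ) x y = content M N (i' : ℕ) x' y') :
    i = i' ∧ ∃ s : ℤ, x' = x + (M / M.gcd N : ℕ) * s ∧ y' = y + (N / M.gcd N : ℕ) * s := by
  have hk : 0 < M.gcd N := Nat.gcd_pos_of_pos_left _ hM
  have hM2 : (M : ℤ) = (M.gcd N : ℕ) * (M / M.gcd N : ℕ) := by
    exact_mod_cast (Nat.mul_div_cancel' (Nat.gcd_dvd_left M N)).symm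
  have hN2 : (N : ℤ) = (M.gcd N : ℕ) * (N / M.gcd N : ℕ) := by
    exact_mod_cast (Nat.mul_div_cancel' (Nat.gcd_dvd_right M N)).symm
  have hcop : IsCoprime ((M / M.gcd N : ℕ) : ℤ) ((N / M.gcd N : ℕ) : ℤ) :=
    Nat.isCoprime_iff_coprime.mpr (Nat.coprime_div_gcd_div_gcd hk)
  have hm : 0 < M / M.gcd N := Nat.div_pos (Nat.le_of_dvd hM (Nat.gcd_dvd_left _ _)) hk
  have hm' : ((M / M.gcd N : ℕ) : ℤ) ≠ 0 := by exact_mod_cast hm.ne'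
  have hi := i.2
  have hi' := i'.2
  have hk' : ((M.gcd N : ℕ) : ℤ) ≠ 0 := by exact_mod_cast hk.ne'
  simp only [content] at h
  generalize ((M / M.gcd N : ℕ) : ℤ) = m at *
  generalize ((N / M.gcd N : ℕ) : ℤ) = n at *
  rw [hM2, hN2] at h
  have hii : (i : ℕ) = i' := by
    have h1 : ((i : ℕ) : ℤ) % (M.gcd N : ℕ) = ((i' : ℕ) : ℤ) % (M.gcd N : ℕ) := by
      apply Int.emod_emod_of_dvd _ (dvd_refl _) |>.symm.trans
      rw [Int.emod_emod_of_dvd _ (dvd_refl _)]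
      apply Int.ModEq.symm
      rw [Int.modEq_iff_dvd]
      exact ⟨m * y' - n * x' - (m * y - n * x), by linear_combination h⟩
    rw [Int.emod_eq_of_lt (by omega) (by omega), Int.emod_eq_of_lt (by omega) (by omega)] at h1
    omega
  refine ⟨Fin.ext hii, ?_⟩
  rw [hii] at h
  have h2 : m * (y' - y) = n * (x' - x) := by
    apply mul_left_cancel₀ hk'
    linear_combination -h
  obtain ⟨s, hs⟩ : m ∣ x' - x := hcop.dvd_of_dvd_mul_left ⟨y' - y, h2.symm⟩
  refine ⟨s, by linarith, ?_⟩
  rw [hs] at h2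
  have : y' - y = n * s := mul_left_cancel₀ hm' (by linear_combination h2)
  linarith

/-- `Above` asks for some representative of the content; periodicity of the path makes all
representatives agree. -/
theorem content_mem_aboveSet (hM : 0 < M) (P : PathTuple M N) (i : Fin (M.gcd N)) (x y : ℤ) :
    content M N (i : ℕ) x y ∈ aboveSet P ↔ x ≤ (P i).x y := by
  constructor
  · rintro ⟨i', x', y', h, hx⟩
    obtain ⟨rfl, s, rfl, rfl⟩ := content_inj hM h.symm
    rw [NEPath.x_add_mul] at hx
    linarith
  · intro h
    exact ⟨i, x, y, rfl, h⟩

/-- `c + N` is the left neighbour of `c`, and the path separates the two exactly when it has a north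
step between them. -/
theorem mem_northCells (hM : 0 < M) (hN : 0 < N) (P : PathTuple M N) (c : ℤ) :
    c ∈ northCells P ↔ c ∉ aboveSet P ∧ c + N ∈ aboveSet P := by
  have key : ∀ i x y, content M N i x y + N = content M N i (x - 1) y := by
    intros; simp only [content]; ring
  constructor
  · intro h
    simp only [northCells, Finset.mem_image, Finset.mem_univ, true_and, Prod.exists] at h
    obtain ⟨i, y, rfl⟩ := h
    rw [key, content_mem_aboveSet hM, content_mem_aboveSet hM]
    constructor <;> linarith
  · obtain ⟨i, x, y, rfl⟩ := exists_content_eq_fin hM hN c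
    rw [key, content_mem_aboveSet hM, content_mem_aboveSet hM]
    rintro ⟨h1, h2⟩
    simp only [northCells, Finset.mem_image, Finset.mem_univ, true_and, Prod.exists]
    refine ⟨i, y, ?_⟩
    rw [show (P i).x (y : ℕ) + 1 = x by omega]

theorem hasEast_iff (hM : 0 < M) (P : PathTuple M N) (c : ℤ) :
    HasEast P c ↔ c ∉ aboveSet P ∧ c + M ∈ aboveSet P := by
  have key : ∀ i x y, content M N i x y + M = content M N i x (y + 1) := by
    intros; simp only [content]; ring
  constructor
  · rintro ⟨i, x, y, rfl, h1, h2⟩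
    rw [key, content_mem_aboveSet hM, content_mem_aboveSet hM]
    constructor <;> linarith
  · obtain ⟨i, x, y, rfl⟩ := exists_content_eq (N := N) hM c
    rw [key, content_mem_aboveSet hM, content_mem_aboveSet hM]
    rintro ⟨h1, h2⟩
    exact ⟨i, x, y, rfl, by omega, h2⟩

theorem add_mul_mem {U : Set ℤ} {a : ℤ} (hU : ∀ c ∈ U, c + a ∈ U) {c : ℤ} (hc : c ∈ U) {s : ℤ}
    (hs : 0 ≤ s) : c + a * s ∈ U := by
  lift s to ℕ using hs
  induction s with
  | zero => simpa using hc
  | succ s ih =>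
    have := hU _ ih
    push_cast
    rwa [show c + a * ((s : ℤ) + 1) = c + a * s + a by ring]

/-- Nonnegativity says that the path stays above the diagonal, and closure under `M` that it is
monotone. Every row contains cells above the path, so every residue class modulo `N` meets the set,
and closure under `N` makes it cofinite. -/
theorem invariantSet_aboveSet (hM : 0 < M) (hN : 0 < N) (P : PathTuple M N) :
    InvariantSet M N (aboveSet P) := by
  have hN' : (0 : ℤ) < N := by exact_mod_cast hN
  have hright : ∀ c ∈ aboveSet P, c + N ∈ aboveSet P := by
    rintro _ ⟨i, x, y, rfl, h⟩
    exact ⟨i, x - 1, y, by simp only [content]; ring, by linarith⟩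
  refine ⟨?_, ?_, hright, ?_⟩
  · rintro _ ⟨i, x, y, rfl, h⟩
    have h1 := (P i).above y
    have hM2 : (M : ℤ) = (M.gcd N : ℕ) * (M / M.gcd N : ℕ) := by
      exact_mod_cast (Nat.mul_div_cancel' (Nat.gcd_dvd_left M N)).symm
    have hN2 : (N : ℤ) = (M.gcd N : ℕ) * (N / M.gcd N : ℕ) := by
      exact_mod_cast (Nat.mul_div_cancel' (Nat.gcd_dvd_right M N)).symm
    have h2 : ((N / M.gcd N : ℕ) : ℤ) * x ≤ (M / M.gcd N : ℕ) * y :=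
      (mul_le_mul_of_nonneg_left h (by positivity)).trans h1
    have h3 := mul_le_mul_of_nonneg_left h2 (Int.natCast_nonneg (M.gcd N))
    rw [← mul_assoc, ← mul_assoc, ← hM2, ← hN2] at h3
    simp only [content]
    omega
  · rintro _ ⟨i, x, y, rfl, h⟩
    exact ⟨i, x, y + 1, by simp only [content]; ring, h.trans ((P i).mono (by omega))⟩
  · have h1 : ∀ c : ℤ, ∃ d ∈ aboveSet P, d % N = c % N := by
      intro c
      obtain ⟨i, x, y, rfl⟩ := exists_content_eq (N := N) hM c
      refine ⟨content M N (i : ℕ) ((P i).x y) y, ⟨i, _, y, rfl, le_rfl⟩, ?_⟩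
      change _ ≡ _ [ZMOD N]
      rw [Int.modEq_iff_dvd]
      exact ⟨(P i).x y - x, by simp only [content]; ring⟩
    choose g hg hg' using h1
    -- This sum bounds every chosen representative `g r`, so beyond it each class is filled.
    refine ⟨∑ r ∈ Finset.range N, |g r|, fun c hc => ?_⟩
    have h0 := Int.emod_nonneg c hN'.ne'
    have h1 := Int.emod_lt_of_pos c hN'
    have h2 : g (c % N) ≤ c := by
      refine le_trans ?_ hc
      have := Finset.single_le_sum (f := fun r : ℕ => |g r|) (fun _ _ => abs_nonneg _)
        (Finset.mem_range.mpr (show (c % N).toNat < N by omega))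
      simp only [Int.toNat_of_nonneg h0] at this
      exact (le_abs_self _).trans this
    have h3 := hg' (c % N)
    rw [Int.emod_emod_of_dvd _ (dvd_refl _)] at h3
    obtain ⟨s, hs⟩ := (Int.modEq_iff_dvd (n := (N : ℤ))).mp h3
    have hs0 : 0 ≤ s := by
      by_contra hneg
      have : (N : ℤ) * s < 0 := mul_neg_of_pos_of_neg hN' (by omega)
      omega
    have := add_mul_mem hright (hg (c % N)) hs0
    rwa [← hs, add_sub_cancel] at this

theorem aboveSet_injective (hM : 0 < M) :
    Function.Injective (aboveSet : PathTuple M N → Set ℤ) := by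
  intro P P' h
  funext i
  ext y
  apply le_antisymm
  · rw [← content_mem_aboveSet hM P' i, ← h, content_mem_aboveSet hM]
  · rw [← content_mem_aboveSet hM P i, h, content_mem_aboveSet hM]

/-- Along a row the content drops by `N` per step to the right, so closure under `N` makes the cells
of `U` an initial ray of the row; its last element is the abscissa of the north step. -/
theorem InvariantSet.exists_aboveSet (hM : 0 < M) (hN : 0 < N) {U : Set ℤ}
    (hU : InvariantSet M N U) : ∃ P : PathTuple M N, aboveSet P = U := by
  have hN' : (0 : ℤ) < N := by exact_mod_cast hN
  have hk : 0 < M.gcd N := Nat.gcd_pos_of_pos_left _ hM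
  have hM2 : (M : ℤ) = (M.gcd N : ℕ) * (M / M.gcd N : ℕ) := by
    exact_mod_cast (Nat.mul_div_cancel' (Nat.gcd_dvd_left M N)).symm
  have hN2 : (N : ℤ) = (M.gcd N : ℕ) * (N / M.gcd N : ℕ) := by
    exact_mod_cast (Nat.mul_div_cancel' (Nat.gcd_dvd_right M N)).symm
  have h1 : ∀ (i : ℕ) (y : ℤ), ∃ x₀ : ℤ, ∀ x, x ≤ x₀ ↔ content M N i x y ∈ U := by
    intro i y
    obtain ⟨B, hB⟩ := hU.cofinite
    obtain ⟨x₀, h1, h2⟩ := Int.exists_greatest_of_bdd (P := fun x => content M N i x y ∈ U)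
      ⟨|(i + M * y : ℤ)|, fun z hz => by
        have := hU.nonneg _ hz
        simp only [content] at this
        by_contra hlt
        push Not at hlt
        have h3 := le_abs_self (i + M * y : ℤ)
        have h4 := abs_nonneg (i + M * y : ℤ)
        nlinarith⟩
      ⟨-|i + M * y - B|, hB _ (by
        simp only [content]
        have h3 := neg_abs_le (i + M * y - B : ℤ)
        have h4 := abs_nonneg (i + M * y - B : ℤ)
        nlinarith)⟩
    refine ⟨x₀, fun x => ⟨fun hx => ?_, h2 x⟩⟩
    have := add_mul_mem hU.add_right h1 (sub_nonneg.mpr hx)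
    convert this using 1
    simp only [content]; ring
  choose X hX using h1
  refine ⟨fun i => ⟨X i, ?_, ?_, ?_⟩, ?_⟩
  · refine monotone_int_of_le_succ fun y => ?_
    rw [hX]
    have := hU.add_left _ ((hX i y _).mp le_rfl)
    convert this using 1
    simp only [content]; ring
  · intro j
    have key : ∀ x, content M N i (x + (M / M.gcd N : ℕ)) (j + (N / M.gcd N : ℕ))
        = content M N i x j := by
      intro x
      simp only [content]
      generalize ((M / M.gcd N : ℕ) : ℤ) = m at *
      generalize ((N / M.gcd N : ℕ) : ℤ) = n at *
      rw [hM2, hN2]; ring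
    apply le_antisymm
    · have h2 : X i (j + (N / M.gcd N : ℕ)) - (M / M.gcd N : ℕ) ≤ X i j := by
        rw [hX, ← key, sub_add_cancel, ← hX]
      linarith
    · rw [hX, key, ← hX]
  · intro j
    have h2 := hU.nonneg _ ((hX i j _).mp le_rfl)
    have hi := i.2
    simp only [content] at h2
    generalize ((M / M.gcd N : ℕ) : ℤ) = m at *
    generalize ((N / M.gcd N : ℕ) : ℤ) = n at *
    rw [hM2, hN2] at h2
    by_contra hlt
    push Not at hlt
    -- A lattice point strictly beyond the diagonal would push the content down by at least the gcd,
    -- more than the sheet index can compensate.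
    have h3 : (M.gcd N : ℤ) * 1 ≤ (M.gcd N : ℤ) * (n * X i j - m * j) :=
      mul_le_mul_of_nonneg_left (by omega) (by positivity)
    have h4 : ((i : ℕ) : ℤ) < M.gcd N := by exact_mod_cast hi
    linarith
  · ext c
    obtain ⟨i, x, y, rfl⟩ := exists_content_eq (N := N) hM c
    rw [content_mem_aboveSet hM]
    exact hX _ _ _

end

end TorusRec

end
noncomputable section

namespace TorusRec

/-! ### Sorted lists and Schröder paths -/

/-- The increasing list of the elements of a finite set of integers. -/
def sortedList (S : Set ℤ) : List ℤ :=
  open Classical in if h : S.Finite then h.toFinset.sort (fun a b => a ≤ b) else []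

theorem sortedList_eq {S : Set ℤ} {l : List ℤ} (hl : l.Pairwise (· < ·))
    (hmem : ∀ c, c ∈ l ↔ c ∈ S) : sortedList S = l := by
  classical
  have hS : S = (l.toFinset : Set ℤ) := by ext c; simp [hmem]
  have hfin : S.Finite := hS ▸ Finset.finite_toSet _
  have h2 : hfin.toFinset = l.toFinset := by ext c; simp [hmem]
  rw [sortedList, dif_pos hfin, h2]
  exact (List.toFinset_sort _ (hl.imp fun h => h.ne)).mpr (hl.imp fun h => h.le)

theorem mem_sortedList {S : Set ℤ} (hS : S.Finite) (c : ℤ) : c ∈ sortedList S ↔ c ∈ S := by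
  rw [sortedList, dif_pos hS]; simp

theorem pairwise_sortedList {S : Set ℤ} (hS : S.Finite) :
    (sortedList S).Pairwise (· < ·) := by
  rw [sortedList, dif_pos hS]
  exact (Finset.sortedLT_sort _).pairwise

theorem sortedList_image {S : Set ℤ} (hS : S.Finite) {φ : ℤ → ℤ}
    (hφ : ∀ a ∈ S, ∀ b ∈ S, a < b → φ a < φ b) :
    sortedList (φ '' S) = (sortedList S).map φ := by
  apply sortedList_eq
  · rw [List.pairwise_map]
    exact (pairwise_sortedList hS).imp_of_mem fun ha hb h =>
      hφ _ ((mem_sortedList hS _).mp ha) _ ((mem_sortedList hS _).mp hb) h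
  · intro c
    simp [mem_sortedList hS]

theorem sortedList_insert {S : Set ℤ} (hS : S.Finite) {a : ℤ} (ha : ∀ b ∈ S, a < b) :
    sortedList (insert a S) = a :: sortedList S := by
  apply sortedList_eq
  · rw [List.pairwise_cons]
    exact ⟨fun b hb => ha b ((mem_sortedList hS _).mp hb), pairwise_sortedList hS⟩
  · intro c
    simp [mem_sortedList hS]

theorem countBelow_cons (a : ℤ) (cs : List ℤ) (b : ℤ) :
    countBelow (a :: cs) b = countBelow cs b + if a < b then 1 else 0 := by
  simp [countBelow, List.countP_cons]

theorem countBelow_map {φ : ℤ → ℤ} {b b' : ℤ} (cs : List ℤ)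
    (h : ∀ c ∈ cs, φ c < b' ↔ c < b) : countBelow (cs.map φ) b' = countBelow cs b := by
  rw [countBelow, countBelow, List.countP_map]
  exact List.countP_congr fun c hc => by simpa using h c hc

theorem countBelow_mono (cs : List ℤ) {b b' : ℤ} (h : b ≤ b') :
    countBelow cs b ≤ countBelow cs b' :=
  List.countP_mono_left fun c _ hc => by
    simp only [decide_eq_true_eq] at hc ⊢
    exact hc.trans_le h

theorem countBelow_add_one {cs : List ℤ} (hcs : cs.Nodup) (b : ℤ) :
    countBelow cs (b + 1) = countBelow cs b + if b ∈ cs then 1 else 0 := by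
  induction cs with
  | nil => simp [countBelow]
  | cons a cs ih =>
    rw [List.nodup_cons] at hcs
    rw [countBelow_cons, countBelow_cons, ih hcs.2]
    by_cases hab : a = b
    · subst hab
      simp [hcs.1]
    · have h1 : a < b + 1 ↔ a < b := by omega
      have h2 : b ≠ a := fun h => hab h.symm
      simp only [h1, List.mem_cons, h2, false_or]
      ring

/-- The path depends only on which entries are less than, or equal to, the entries moved up by `M`.
-/
theorem schroederFrom_map {M : ℕ} {φ : ℤ → ℤ} {cs : List ℤ} {rest : List ℤ} (h : ℕ)
    (h1 : ∀ c ∈ rest, ∀ d ∈ cs, φ d < φ c + M ↔ d < c + M)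
    (h2 : ∀ c ∈ rest, φ c + M ∈ cs.map φ ↔ c + M ∈ cs) :
    schroederFrom M (cs.map φ) h (rest.map φ) = schroederFrom M cs h rest := by
  induction rest generalizing h with
  | nil => rfl
  | cons c rest ih =>
    have h3 := countBelow_map (φ := φ) cs (h1 c List.mem_cons_self)
    have ih' := fun h => ih h (fun c hc => h1 c (List.mem_cons_of_mem _ hc))
      (fun c hc => h2 c (List.mem_cons_of_mem _ hc))
    rw [List.map_cons, schroederFrom, schroederFrom, h3, ih', ih']
    simp only [h2 c List.mem_cons_self]

/-- An extra entry `a` below every threshold `c + M` raises all heights by one, which the raised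
starting height absorbs. -/
theorem schroederFrom_cons {M : ℕ} {a : ℤ} {cs rest : List ℤ} (h : ℕ)
    (ha : ∀ c ∈ rest, a < c + M) :
    schroederFrom M (a :: cs) (h + 1) rest = schroederFrom M cs h rest := by
  induction rest generalizing h with
  | nil => rfl
  | cons c rest ih =>
    have h1 := ha c List.mem_cons_self
    have h2 : c + M ≠ a := h1.ne'
    have ih' := fun h => ih h (fun c hc => ha c (List.mem_cons_of_mem _ hc))
    rw [schroederFrom, schroederFrom, countBelow_cons, if_pos h1, ih', ih', Nat.add_sub_add_right]
    simp only [List.mem_cons, h2, false_or]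

theorem schroederFrom_of_lt {M : ℕ} {c : ℤ} {cs rest : List ℤ} {h : ℕ}
    (hc : h < countBelow cs (c + M)) :
    schroederFrom M cs h (c :: rest)
      = Step.vertical :: schroederFrom M cs (h + 1) (c :: rest) := by
  rw [schroederFrom, schroederFrom]
  obtain ⟨d, hd⟩ := Nat.exists_eq_add_of_lt hc
  rw [hd, show h + d + 1 - h = d + 1 by omega, show h + d + 1 - (h + 1) = d by omega,
    List.replicate_succ, List.cons_append]

/-- After raising the list by one, the starting height counts the entries `≤ M` rather than `< M`;
whether `M` is an entry decides whether this differs from the usual starting height. -/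
theorem schroeder_map_succ {M : ℕ} {cs : List ℤ} (hcs : cs.Nodup) :
    schroeder M cs = schroederFrom M (cs.map (· + 1))
      (countBelow (cs.map (· + 1)) M + if (M : ℤ) ∈ cs.map (· + 1) then 1 else 0)
      (cs.map (· + 1)) := by
  have h1 : countBelow (cs.map (· + 1)) M = countBelow cs (M - 1) :=
    countBelow_map _ fun c _ => by constructor <;> intro h <;> linarith
  have h2 : (M : ℤ) ∈ cs.map (· + 1) ↔ (M - 1 : ℤ) ∈ cs := by
    simp only [List.mem_map]
    exact ⟨fun ⟨a, ha, h⟩ => by rwa [← h, add_sub_cancel_right], fun h => ⟨_, h, by ring⟩⟩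
  rw [schroederFrom_map, h1, schroeder]
  · congr 1
    have h3 := countBelow_add_one hcs (M - 1)
    rw [sub_add_cancel] at h3
    simp only [h2, h3]
  · intro c _ d _
    constructor <;> intro h <;> linarith
  · intro c _
    simp only [List.mem_map]
    constructor
    · rintro ⟨a, ha, h⟩
      rwa [show c + M = a by linarith]
    · intro h
      exact ⟨_, h, by ring⟩

/-! ### Statistics of invariant sets -/

/-- The nonnegative cells with a north step. -/
def northSet (N : ℕ) (U : Set ℤ) : Set ℤ := {c | 0 ≤ c ∧ c ∉ U ∧ c + N ∈ U}

/-- The cells counted by the area. -/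
def areaSet (M N : ℕ) (U : Set ℤ) : Set ℤ := {c | (M : ℤ) + N ≤ c ∧ c ∉ U}

/-- The pairs of cells counted by `pdinv`. -/
def pdinvSet (M N : ℕ) (U : Set ℤ) : Set (ℤ × ℤ) :=
  {cd | cd.1 < cd.2 ∧ (M : ℤ) ≤ cd.2 ∧ cd.2 < cd.1 + M ∧ cd.1 ∈ northSet N U ∧ cd.2 ∉ U}

/-- The letter that records the position of the cell `c`. -/
def letter (N : ℕ) (U : Set ℤ) (c : ℤ) : Letter :=
  open Classical in if c ∈ U then .bullet else if c + N ∈ U then .one else .zero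

/-- The word of the cells `0, …, M - 1`. -/
def word (M N : ℕ) (U : Set ℤ) : List Letter := (List.range M).map fun i : ℕ => letter N U i

theorem letter_eq_bullet {N : ℕ} {U : Set ℤ} {c : ℤ} : letter N U c = .bullet ↔ c ∈ U := by
  unfold letter; split_ifs <;> simp_all

theorem letter_eq_one {N : ℕ} {U : Set ℤ} {c : ℤ} :
    letter N U c = .one ↔ c ∉ U ∧ c + N ∈ U := by
  unfold letter; split_ifs <;> simp_all

theorem letter_eq_zero {N : ℕ} {U : Set ℤ} {c : ℤ} :
    letter N U c = .zero ↔ c ∉ U ∧ c + N ∉ U := by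
  unfold letter; split_ifs <;> simp_all

theorem word_succ_eq_cons (M N : ℕ) (U : Set ℤ) : word (M + 1) N U =
    letter N U 0 :: (List.range M).map fun i : ℕ => letter N U (i + 1) := by
  simp [word, List.range_succ_eq_map, List.map_map, Function.comp_def]

theorem word_succ_eq_append (M N : ℕ) (U : Set ℤ) : word (M + 1) N U =
    (List.range M).map (fun i : ℕ => letter N U i) ++ [letter N U M] := by
  simp [word, List.range_succ]

/-- The set `U'` is `U` moved down by one, within the nonnegative integers. -/
def IsShift (U U' : Set ℤ) : Prop := ∀ c, 0 ≤ c → (c ∈ U' ↔ c + 1 ∈ U)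

theorem IsShift.letter_eq {U U' : Set ℤ} (h : IsShift U U') (N : ℕ) {c : ℤ} (hc : 0 ≤ c) :
    letter N U' c = letter N U (c + 1) := by
  unfold letter
  rw [h c hc, h (c + N) (by omega), add_right_comm]

theorem IsShift.word_eq {U U' : Set ℤ} (h : IsShift U U') (M N : ℕ) : word (M + 1) N U' =
    (List.range M).map (fun i : ℕ => letter N U (i + 1)) ++ [letter N U (M + 1)] := by
  rw [word_succ_eq_append, h.letter_eq N (by omega)]
  congr 1
  exact List.map_congr_left fun i _ => h.letter_eq N (by omega)

section

variable {M N : ℕ} {U U' : Set ℤ}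

theorem InvariantSet.finite_compl (hU : InvariantSet M N U) (b : ℤ) :
    {c | b ≤ c ∧ c ∉ U}.Finite := by
  obtain ⟨B, hB⟩ := hU.cofinite
  refine (Set.finite_Ico b B).subset fun c hc => ⟨hc.1, ?_⟩
  by_contra h
  exact hc.2 (hB c (not_lt.mp h))

theorem InvariantSet.finite_northSet (hU : InvariantSet M N U) : (northSet N U).Finite :=
  (hU.finite_compl 0).subset fun _ hc => ⟨hc.1, hc.2.1⟩

theorem InvariantSet.finite_pdinvSet (hU : InvariantSet M N U) : (pdinvSet M N U).Finite :=
  ((hU.finite_compl 0).prod (hU.finite_compl M)).subset fun _ hc =>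
    ⟨⟨hc.2.2.2.1.1, hc.2.2.2.1.2.1⟩, hc.2.1, hc.2.2.2.2⟩

theorem InvariantSet.symm (hU : InvariantSet M N U) : InvariantSet N M U :=
  ⟨hU.nonneg, hU.add_right, hU.add_left, hU.cofinite⟩

/-! ### Effect of the shift on area, pdinv and the Schröder path -/

theorem IsShift.image_areaSet (h : IsShift U U') (hN : 0 < M + N) :
    areaSet M N U = (· + 1) '' areaSet M N U' ∪ {c : ℤ | c = M + N ∧ c ∉ U} := by
  ext c
  simp only [areaSet, Set.mem_ofPred_eq, Set.image_add_right, Set.mem_preimage, Set.mem_union]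
  by_cases hc : 0 ≤ c + -1
  · rw [h _ hc]
    simp only [neg_add_cancel_right]
    by_cases hcU : c ∈ U
    · simp [hcU]
    · simp only [hcU, not_false_eq_true, and_true]
      omega
  · constructor
    · rintro ⟨h1, _⟩
      omega
    · rintro (⟨h1, -⟩ | ⟨h1, -⟩) <;> omega

theorem IsShift.ncard_areaSet (h : IsShift U U') (hU : InvariantSet M N U) (hN : 0 < M + N) :
    (areaSet M N U).ncard = (areaSet M N U').ncard +
      open Classical in if (M : ℤ) + N ∈ U then 0 else 1 := by
  have himg := h.image_areaSet hN
  have hfin := hU.finite_compl (M + N)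
  have hfin1 : ((· + 1) '' areaSet M N U').Finite :=
    hfin.subset (by change _ ⊆ areaSet M N U; rw [himg]; exact Set.subset_union_left)
  rw [himg]
  split_ifs with hMN
  · have : {c : ℤ | c = M + N ∧ c ∉ U} = ∅ := by
      ext c
      simp only [Set.mem_ofPred_eq, Set.mem_empty_iff_false, iff_false, not_and, not_not]
      rintro rfl; exact hMN
    rw [this, Set.union_empty, Set.ncard_image_of_injective _ (add_left_injective 1), add_zero]
  · have : {c : ℤ | c = M + N ∧ c ∉ U} = {(M : ℤ) + N} := by
      ext c
      simp only [Set.mem_ofPred_eq, Set.mem_singleton_iff, and_iff_left_iff_imp]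
      rintro rfl; exact hMN
    rw [this, Set.ncard_union_eq _ hfin1 (Set.finite_singleton _),
      Set.ncard_image_of_injective _ (add_left_injective 1), Set.ncard_singleton]
    rw [Set.disjoint_singleton_right]
    rintro ⟨c, hc, hc'⟩
    have := hc.1
    simp only at hc'
    omega

theorem IsShift.northSet_eq (h : IsShift U U') :
    (· + 1) '' northSet N U' = {c | 0 < c ∧ c ∈ northSet N U} := by
  ext c
  simp only [northSet, Set.mem_ofPred_eq, Set.image_add_right, Set.mem_preimage]
  by_cases hc : 0 ≤ c + -1
  · rw [h _ hc, h _ (by omega), neg_add_cancel_right,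
      show c + -1 + N + 1 = c + N by ring]
    constructor
    · rintro ⟨-, h1⟩; exact ⟨by omega, by omega, h1⟩
    · rintro ⟨-, -, h1⟩; exact ⟨hc, h1⟩
  · constructor
    · rintro ⟨h1, -⟩; omega
    · rintro ⟨h1, -⟩; omega

/-- A pair is lost only when `d = M`, since then `d` leaves the admissible range; in that case `d <
c + M` reads `0 < c`. Pairs with `c = 0` do not exist, as they would need `M ≤ d < M`. -/
theorem IsShift.ncard_pdinvSet (h : IsShift U U') (hU : InvariantSet M N U) :
    (pdinvSet M N U).ncard = (pdinvSet M N U').ncard +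
      open Classical in if (M : ℤ) ∈ U then 0 else
        {c : ℤ | 0 < c ∧ c < M ∧ c ∈ northSet N U}.ncard := by
  have hfin := hU.finite_pdinvSet
  have himg : pdinvSet M N U = (fun cd : ℤ × ℤ => (cd.1 + 1, cd.2 + 1)) '' pdinvSet M N U' ∪
      (fun c : ℤ => (c, (M : ℤ))) '' {c : ℤ | (M : ℤ) ∉ U ∧ 0 < c ∧ c < M ∧ c ∈ northSet N U} := by
    ext ⟨c, d⟩
    simp only [Set.mem_union, Set.mem_image, Prod.exists, Prod.mk.injEq]
    constructor
    · rintro ⟨h1, h2, h3, h4, h5⟩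
      simp only at h1 h2 h3 h4 h5
      have hc : 0 < c := by omega
      by_cases hd : d = M
      · subst hd
        exact Or.inr ⟨c, ⟨h5, hc, h1, h4⟩, rfl, rfl⟩
      · have h6 : c ∈ (· + 1) '' northSet N U' := by rw [h.northSet_eq]; exact ⟨hc, h4⟩
        obtain ⟨c', hc', rfl⟩ := h6
        refine Or.inl ⟨c', d - 1, ⟨?_, ?_, ?_, hc', ?_⟩, rfl, by ring⟩
        · simp only at h1 ⊢; omega
        · simp only; omega
        · simp only at h3 ⊢; omega
        · simp only
          rw [h _ (by omega), sub_add_cancel]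
          exact h5
    · rintro (⟨c', d', ⟨h1, h2, h3, h4, h5⟩, rfl, rfl⟩ | ⟨c', ⟨h1, h2, h3, h4⟩, rfl, rfl⟩)
      · simp only at h1 h2 h3 h4 h5
        have h6 : c' + 1 ∈ (· + 1) '' northSet N U' := ⟨c', h4, rfl⟩
        rw [h.northSet_eq] at h6
        rw [h _ (by omega)] at h5
        refine ⟨?_, ?_, ?_, h6.2, h5⟩ <;> simp only <;> omega
      · refine ⟨?_, ?_, ?_, h4, h1⟩ <;> simp only <;> omega
  rw [himg] at hfin ⊢
  rw [Set.ncard_union_eq _ (hfin.subset Set.subset_union_left)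
    (hfin.subset Set.subset_union_right), Set.ncard_image_of_injective,
    Set.ncard_image_of_injective]
  · split_ifs with hM
    · simp [hM]
    · simp [hM]
  · intro a b hab
    simpa using hab
  · rintro ⟨a, b⟩ ⟨a', b'⟩ hab
    simpa using hab
  · rw [Set.disjoint_left]
    rintro _ ⟨⟨c, d⟩, hcd, rfl⟩ ⟨c', hc', hh⟩
    have := hcd.2.1
    simp only [Prod.mk.injEq] at hh this
    omega

/-- This identifies the pairs lost by pdinv with the ones of the word stripped of its first letter.
-/
theorem ones_map_letter (m : ℕ) :
    ones ((List.range m).map fun i : ℕ => letter N U (i + 1))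
      = {c : ℤ | 0 < c ∧ c < (m + 1 : ℕ) ∧ c ∈ northSet N U}.ncard := by
  classical
  have h1 : {c : ℤ | 0 < c ∧ c < (m + 1 : ℕ) ∧ c ∈ northSet N U}
      = ((fun i : ℕ => (i : ℤ) + 1) ''
        ((Finset.range m).filter fun i : ℕ => letter N U (i + 1) = .one : Finset ℕ)) := by
    ext c
    simp only [Set.mem_ofPred_eq, Finset.coe_filter, Finset.mem_range, Set.mem_image,
      letter_eq_one, northSet]
    constructor
    · rintro ⟨h1, h2, h3, h4⟩
      have h5 : ((c - 1).toNat : ℤ) + 1 = c := by omega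
      exact ⟨(c - 1).toNat, ⟨by omega, by rw [h5]; exact h4⟩, h5⟩
    · rintro ⟨i, ⟨h1, h2⟩, rfl⟩
      exact ⟨by omega, by push_cast; omega, by omega, h2⟩
  rw [h1, Set.ncard_image_of_injective _ (fun a b hab => by simpa using hab),
    Set.ncard_coe_finset, ones, List.count, List.countP_map, List.countP_eq_length_filter,
    ← List.toFinset_card_of_nodup (List.nodup_range.filter _)]
  congr 1
  ext i
  simp

theorem IsShift.sortedList_eq_of_not_mem (h : IsShift U U') (hU' : InvariantSet M N U')
    (h0 : (0 : ℤ) ∉ northSet N U) :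
    sortedList (northSet N U) = (sortedList (northSet N U')).map (· + 1) := by
  rw [← sortedList_image hU'.finite_northSet (fun _ _ _ _ hab => by linarith), h.northSet_eq]
  congr 1
  ext c
  refine ⟨fun hc => ⟨lt_of_le_of_ne hc.1 ?_, hc⟩, fun hc => hc.2⟩
  rintro rfl
  exact h0 hc

theorem IsShift.sortedList_eq_of_mem (h : IsShift U U') (hU' : InvariantSet M N U')
    (h0 : (0 : ℤ) ∈ northSet N U) :
    sortedList (northSet N U) = 0 :: (sortedList (northSet N U')).map (· + 1) := by
  have hfin := hU'.finite_northSet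
  rw [← sortedList_image hfin (fun _ _ _ _ hab => by linarith),
    ← sortedList_insert (hfin.image _) (by rw [h.northSet_eq]; exact fun _ hb => hb.1),
    h.northSet_eq]
  congr 1
  ext c
  simp only [Set.mem_insert_iff, Set.mem_ofPred_eq]
  constructor
  · intro hc
    have := hc.1
    rcases this.eq_or_lt with h1 | h1
    · exact Or.inl h1.symm
    · exact Or.inr ⟨h1, hc⟩
  · rintro (rfl | hc)
    exacts [h0, hc.2]

/-- The list of steps of the partial Schröder path of an invariant set. -/
def steps (M N : ℕ) (U : Set ℤ) : List Step := schroeder M (sortedList (northSet N U))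

theorem IsShift.steps_eq (h : IsShift U U') (hU' : InvariantSet M N U')
    (h0 : (0 : ℤ) ∉ northSet N U) (hM : (M : ℤ) ∉ northSet N U) :
    steps M N U = steps M N U' := by
  have hfin := hU'.finite_northSet
  have h1 := h.sortedList_eq_of_not_mem hU' h0
  -- On an infinite set `sortedList` is `[]`, which has no elements.
  have h2 : (M : ℤ) ∉ sortedList (northSet N U) := fun h3 => hM <| by
    have hS : (northSet N U).Finite := by
      by_contra hinf
      rw [sortedList, dif_neg hinf] at h3
      simp at h3
    exact (mem_sortedList hS _).mp h3
  rw [h1] at h2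
  rw [steps, steps, schroeder_map_succ ((pairwise_sortedList hfin).imp fun h => h.ne), if_neg h2,
    add_zero, h1, schroeder]

/-- Cell `M` becomes cell `M - 1`, a new basement north step, so the path of `U'` starts one higher.
-/
theorem IsShift.steps_eq_vertical (h : IsShift U U') (hU : InvariantSet M N U)
    (hU' : InvariantSet M N U')
    (h0 : (0 : ℤ) ∉ northSet N U) (hM : (M : ℤ) ∈ northSet N U) :
    steps M N U = .vertical :: steps M N U' := by
  have hfin := hU'.finite_northSet
  have h1 := h.sortedList_eq_of_not_mem hU' h0
  have h2 := (mem_sortedList hU.finite_northSet _).mpr hM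
  have h3 := pairwise_sortedList hU.finite_northSet
  have h4 : ∀ c ∈ sortedList (northSet N U), 0 < c := by
    rw [h1]
    intro c hc
    simp only [List.mem_map, mem_sortedList hfin] at hc
    obtain ⟨a, ha, rfl⟩ := hc
    have := ha.1
    omega
  rw [steps, steps, schroeder_map_succ ((pairwise_sortedList hfin).imp fun h => h.ne), ← h1,
    if_pos h2, schroeder]
  have h5 := countBelow_add_one (h3.imp fun h => h.ne) (M : ℤ)
  rw [if_pos h2] at h5
  generalize sortedList (northSet N U) = cs at *
  cases cs with
  | nil => simp at h2
  | cons c rest =>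
    apply schroederFrom_of_lt
    have h6 := h4 c List.mem_cons_self
    -- All columns have `c > 0`, so the height of the first one also counts the entry `M`: there is
    -- room for a vertical step.
    have h7 := countBelow_mono (c :: rest) (show (M : ℤ) + 1 ≤ c + M by omega)
    omega

/-- The first column belongs to cell `0`, whose threshold `0 + M` is already the starting height: no
vertical step precedes, and the column has a diagonal step only if `M` is an entry. Removing the
entry `0` then lowers all later heights by one. -/
theorem IsShift.steps_eq_horizontal (h : IsShift U U') (hM0 : 0 < M) (hU : InvariantSet M N U)
    (hU' : InvariantSet M N U')
    (h0 : (0 : ℤ) ∈ northSet N U) (hM : (M : ℤ) ∉ northSet N U) :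
    steps M N U = .horizontal :: steps M N U' := by
  have hfin := hU'.finite_northSet
  have h1 := h.sortedList_eq_of_mem hU' h0
  have h2 := (mem_sortedList hU.finite_northSet _).not.mpr hM
  have hM1 : (0 : ℤ) < M := by exact_mod_cast hM0
  rw [steps, steps, schroeder_map_succ ((pairwise_sortedList hfin).imp fun h => h.ne), schroeder,
    h1] at *
  have h3 := fun h => h2 (List.mem_cons_of_mem _ h)
  rw [if_neg h3, schroederFrom, zero_add, if_neg h2, Nat.sub_self, List.replicate_zero,
    List.nil_append, countBelow_cons, if_pos hM1, schroederFrom_cons, add_zero]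
  intro c hc
  simp only [List.mem_map, mem_sortedList hfin] at hc
  obtain ⟨a, ha, rfl⟩ := hc
  have := ha.1
  omega

theorem IsShift.steps_eq_diagonal (h : IsShift U U') (hM0 : 0 < M) (hU : InvariantSet M N U)
    (hU' : InvariantSet M N U')
    (h0 : (0 : ℤ) ∈ northSet N U) (hM : (M : ℤ) ∈ northSet N U) :
    steps M N U = .diagonal :: steps M N U' := by
  have hfin := hU'.finite_northSet
  have h1 := h.sortedList_eq_of_mem hU' h0
  have h2 := (mem_sortedList hU.finite_northSet _).mpr hM
  have hM1 : (0 : ℤ) < M := by exact_mod_cast hM0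
  rw [steps, steps, schroeder_map_succ ((pairwise_sortedList hfin).imp fun h => h.ne), schroeder,
    h1] at *
  have h3 := (List.mem_cons.mp h2).resolve_left hM1.ne'
  rw [if_pos h3, schroederFrom, zero_add, if_pos h2, Nat.sub_self, List.replicate_zero,
    List.nil_append, countBelow_cons, if_pos hM1, schroederFrom_cons]
  intro c hc
  simp only [List.mem_map, mem_sortedList hfin] at hc
  obtain ⟨a, ha, rfl⟩ := hc
  have := ha.1
  omega

end

end TorusRec

end
noncomputable section

namespace TorusRec

/-! ### Generating functions of families of invariant sets -/

section

variable {K : Type*} [Field K] {M N : ℕ}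

/-- The contribution of an invariant set to the generating function. -/
def weight (t : K) (l M N : ℕ) (U : Set ℤ) : V K l :=
  t ^ (-((pdinvSet M N U).ncard : ℤ)) • evalSteps t l (steps M N U)

/-- The generating function of a family of invariant sets. -/
def gen (t : K) (l M N : ℕ) (A : Set (Set ℤ)) : PowerSeries (V K l) :=
  PowerSeries.mk fun a => ∑ᶠ U ∈ {U | U ∈ A ∧ (areaSet M N U).ncard = a}, weight t l M N U

/-- The invariant sets with given words. -/
def family (M N : ℕ) (v w : List Letter) : Set (Set ℤ) :=
  {U | InvariantSet M N U ∧ word M N U = v ∧ word N M U = w}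

/-! ### From path tuples to invariant sets -/

theorem word_eq_iff {v : List Letter} {U : Set ℤ} :
    word v.length N U = v ↔ ∀ (i : ℕ) (h : i < v.length), v[i] = letter N U i := by
  constructor
  · intro h i hi
    rw [List.getElem_of_eq h.symm hi]
    simp [word]
  · intro h
    apply List.ext_getElem (by simp [word])
    intro i h1 h2
    rw [h i h2]
    simp [word]

theorem fits_iff {v w : List Letter} (hv : v ≠ []) (hw : w ≠ [])
    (P : PathTuple v.length w.length) :
    Fits v w P ↔ aboveSet P ∈ family v.length w.length v w := by
  have hM := List.length_pos_iff.mpr hv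
  have hN := List.length_pos_iff.mpr hw
  have hb : ∀ c, Below P c ↔ c ∉ aboveSet P := fun _ => Iff.rfl
  have ha : ∀ c, Above P c ↔ c ∈ aboveSet P := fun _ => Iff.rfl
  have hn : ∀ c, HasNorth P c ↔ c ∉ aboveSet P ∧ c + w.length ∈ aboveSet P :=
    mem_northCells hM hN P
  have he := hasEast_iff (N := w.length) hM P
  have key : ∀ (x : Letter) (n : ℕ) (c : ℤ), x = letter n (aboveSet P) c ↔
      (x = .zero ↔ c ∉ aboveSet P ∧ ¬ (c ∉ aboveSet P ∧ c + n ∈ aboveSet P)) ∧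
      (x = .one ↔ c ∉ aboveSet P ∧ c + n ∈ aboveSet P) ∧
      (x = .bullet ↔ c ∈ aboveSet P) := by
    intro x n c
    unfold letter
    cases x <;> split_ifs <;> simp_all
  simp only [family, Set.mem_ofPred_eq, invariantSet_aboveSet hM hN P, true_and, word_eq_iff, key]
  constructor
  · rintro ⟨h1, h2, h3, h4, h5, h6⟩
    simp only [hb, ha, hn, he] at h1 h2 h3 h4 h5 h6
    exact ⟨fun i h => ⟨h1 i h, h2 i h, h3 i h⟩, fun i h => ⟨h4 i h, h5 i h, h6 i h⟩⟩
  · rintro ⟨h1, h2⟩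
    constructor <;> intro i h <;> simp only [hb, ha, hn, he]
    exacts [(h1 i h).1, (h1 i h).2.1, (h1 i h).2.2, (h2 i h).1, (h2 i h).2.1, (h2 i h).2.2]

theorem chi_eq (hM : 0 < M) (hN : 0 < N) (t : K) (l : ℕ) (P : PathTuple M N) :
    chi t l P = evalSteps t l (steps M N (aboveSet P)) := by
  rw [chi, steps]
  congr 2
  symm
  apply sortedList_eq
  · exact (Finset.sortedLT_sort _).pairwise
  · intro c
    simp [northList, northSet, mem_northCells hM hN, and_comm]

theorem pdinv_eq (hM : 0 < M) (hN : 0 < N) (P : PathTuple M N) :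
    pdinv P = (pdinvSet M N (aboveSet P)).ncard := by
  have hn : ∀ c, HasNorth P c ↔ c ∉ aboveSet P ∧ c + N ∈ aboveSet P := mem_northCells hM hN P
  have hb : ∀ c, Below P c ↔ c ∉ aboveSet P := fun _ => Iff.rfl
  rw [pdinv]
  congr 1
  ext ⟨c, d⟩
  simp only [pdinvSet, northSet, Set.mem_ofPred_eq, hn, hb]
  tauto

theorem bijOn_fits {v w : List Letter} (hv : v ≠ []) (hw : w ≠ []) (a : ℕ) :
    Set.BijOn aboveSet {P : PathTuple v.length w.length | Fits v w P ∧ area P = a}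
      {U | U ∈ family v.length w.length v w ∧ (areaSet v.length w.length U).ncard = a} := by
  have hM := List.length_pos_iff.mpr hv
  have hN := List.length_pos_iff.mpr hw
  refine ⟨fun P hP => ⟨(fits_iff hv hw P).mp hP.1, hP.2⟩, (aboveSet_injective hM).injOn, ?_⟩
  rintro U ⟨hU, hU2⟩
  obtain ⟨P, rfl⟩ := hU.1.exists_aboveSet hM hN
  exact ⟨P, ⟨(fits_iff hv hw P).mpr hU, hU2⟩, rfl⟩

theorem L_eq_gen {v w : List Letter} (hv : v ≠ []) (hw : w ≠ []) {M N : ℕ} (hvM : v.length = M)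
    (hwN : w.length = N) (t : K) (l : ℕ) : L t l v w = gen t l M N (family M N v w) := by
  subst hvM hwN
  have hM := List.length_pos_iff.mpr hv
  have hN := List.length_pos_iff.mpr hw
  ext1 a
  rw [L, gen, PowerSeries.coeff_mk, PowerSeries.coeff_mk]
  refine finsum_mem_eq_of_bijOn _ (bijOn_fits hv hw a) fun P _ => ?_
  rw [weight, chi_eq hM hN, pdinv_eq hM hN]

/-- Bounded area forces `U` to contain everything from a fixed bound on, so `U` is determined by a
subset of a finite interval. -/
theorem InvariantSet.finite_ncard_areaSet_eq (hM : 0 < M) (a : ℕ) :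
    {U | InvariantSet M N U ∧ (areaSet M N U).ncard = a}.Finite := by
  have hM' : (0 : ℤ) < M := by exact_mod_cast hM
  -- If `c ≥ B` were below, so would be `c, c - M, …, c - a M`, all at least `M + N`: these are `a +
  -- 1` area cells.
  let B : ℤ := M + N + M * a
  have hB : ∀ U, InvariantSet M N U → (areaSet M N U).ncard = a → ∀ c, B ≤ c → c ∈ U := by
    intro U hU ha c hc
    by_contra hcU
    have h1 : ∀ j ∈ Finset.range (a + 1), c - M * (j : ℤ) ∈ areaSet M N U := by
      intro j hj
      have hj' : (j : ℤ) ≤ a := by exact_mod_cast Finset.mem_range_succ_iff.mp hj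
      refine ⟨?_, fun h => hcU ?_⟩
      · have := mul_le_mul_of_nonneg_left hj' hM'.le
        linarith
      · have := add_mul_mem hU.add_left h (Int.natCast_nonneg j)
        rwa [sub_add_cancel] at this
    have h2 := Set.ncard_le_ncard (t := areaSet M N U)
      (s := (fun j : ℕ => c - M * (j : ℤ)) '' (Finset.range (a + 1)))
      (Set.image_subset_iff.mpr fun j hj => h1 j (Finset.mem_coe.mp hj)) (hU.finite_compl _)
    rw [Set.ncard_image_of_injective _ (fun i j hij => by
      have : (M : ℤ) * i = M * j := by simpa using hij
      exact_mod_cast mul_left_cancel₀ hM'.ne' this), Set.ncard_coe_finset, Finset.card_range,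
      ha] at h2
    omega
  refine Set.Finite.of_finite_image (f := fun U => U ∩ Set.Ico 0 B)
    ((Set.finite_Ico 0 B).finite_subsets.subset ?_) ?_
  · rintro _ ⟨U, -, rfl⟩
    exact Set.inter_subset_right
  · rintro U ⟨hU, hUa⟩ U' ⟨hU', hUa'⟩ h
    ext c
    by_cases hc : B ≤ c
    · exact iff_of_true (hB U hU hUa c hc) (hB U' hU' hUa' c hc)
    by_cases hc0 : 0 ≤ c
    · have := Set.ext_iff.mp h c
      simpa [hc0, not_le.mp hc] using this
    · exact iff_of_false (fun h => hc0 (hU.nonneg c h)) (fun h => hc0 (hU'.nonneg c h))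

theorem finite_fits {v w : List Letter} (hv : v ≠ []) (hw : w ≠ []) (a : ℕ) :
    {P : PathTuple v.length w.length | Fits v w P ∧ area P = a}.Finite := by
  have h := bijOn_fits hv hw a
  refine Set.Finite.of_finite_image ?_ h.injOn
  rw [h.image_eq]
  exact (InvariantSet.finite_ncard_areaSet_eq (List.length_pos_iff.mpr hv) a).subset
    fun U hU => ⟨hU.1.1, hU.2⟩

/-- All the recursions use this transport: a bijection that lowers the area by `e` and relates the
weights by `d`. Finiteness in each degree lets `d` pass through the sum. -/
theorem gen_eq_of_bijOn (hM : 0 < M) (t : K) {l l' : ℕ} {A A' : Set (Set ℤ)}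
    {φ : Set ℤ → Set ℤ} (hφ : Set.BijOn φ A A') (hA' : ∀ U ∈ A', InvariantSet M N U)
    (d : V K l' →ₗ[K] V K l) (e : ℕ)
    (harea : ∀ U ∈ A, (areaSet M N U).ncard = (areaSet M N (φ U)).ncard + e)
    (hweight : ∀ U ∈ A, weight t l M N U = d (weight t l' M N (φ U))) :
    gen t l M N A = PowerSeries.X ^ e * qExt d (gen t l' M N A') := by
  ext1 a
  rw [PowerSeries.coeff_X_pow_mul', gen, PowerSeries.coeff_mk]
  split_ifs with hea
  · rw [qExt, PowerSeries.coeff_mk, gen, PowerSeries.coeff_mk]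
    have hfin : {U | U ∈ A' ∧ (areaSet M N U).ncard = a - e}.Finite :=
      (InvariantSet.finite_ncard_areaSet_eq hM (a - e)).subset fun U hU => ⟨hA' U hU.1, hU.2⟩
    have h1 := d.toAddMonoidHom.map_finsum_mem (fun U => weight t l' M N U) hfin
    simp only [LinearMap.toAddMonoidHom_coe] at h1
    rw [h1]
    refine finsum_mem_eq_of_bijOn φ ⟨?_, ?_, ?_⟩ fun U hU => hweight U hU.1
    · rintro U ⟨hU, hUa⟩
      have := harea U hU
      exact ⟨hφ.mapsTo hU, by omega⟩
    · exact hφ.injOn.mono fun U hU => hU.1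
    · rintro U' ⟨hU', hUa'⟩
      obtain ⟨U, hU, rfl⟩ := hφ.surjOn hU'
      have := harea U hU
      exact ⟨U, ⟨hU, by omega⟩, rfl⟩
  · have : {U | U ∈ A ∧ (areaSet M N U).ncard = a} = ∅ := by
      ext U
      simp only [Set.mem_ofPred_eq, Set.mem_empty_iff_false, iff_false, not_and]
      intro hU hUa
      have := harea U hU
      omega
    rw [this, finsum_mem_empty]

theorem gen_union (hM : 0 < M) (t : K) (l : ℕ) {A A' : Set (Set ℤ)}
    (hA : ∀ U ∈ A, InvariantSet M N U) (hA' : ∀ U ∈ A', InvariantSet M N U)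
    (hd : Disjoint A A') : gen t l M N (A ∪ A') = gen t l M N A + gen t l M N A' := by
  ext1 a
  rw [map_add, gen, gen, gen, PowerSeries.coeff_mk, PowerSeries.coeff_mk, PowerSeries.coeff_mk]
  have hfin := InvariantSet.finite_ncard_areaSet_eq (N := N) hM a
  rw [← finsum_mem_union]
  · congr 1
    ext U
    congr 1
    simp only [Set.mem_union, Set.mem_ofPred_eq, or_and_right]
  · exact hd.mono (fun U hU => hU.1) fun U hU => hU.1
  · exact hfin.subset fun U hU => ⟨hA U hU.1, hU.2⟩
  · exact hfin.subset fun U hU => ⟨hA' U hU.1, hU.2⟩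

theorem qExt_id {l : ℕ} (F : PowerSeries (V K l)) :
    qExt (LinearMap.id : V K l →ₗ[K] V K l) F = F := by
  ext1 a
  rw [qExt, PowerSeries.coeff_mk, LinearMap.id_apply]

theorem qExt_smul {l l' : ℕ} (c : K) (d : V K l →ₗ[K] V K l') (F : PowerSeries (V K l)) :
    qExt (c • d) F = c • qExt d F := by
  ext1 a
  rw [PowerSeries.coeff_smul, qExt, qExt, PowerSeries.coeff_mk, PowerSeries.coeff_mk,
    LinearMap.smul_apply]

end

/-! ### The shift of invariant sets -/

/-- The set `U` moved down by one, within the nonnegative integers. -/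
def shift (U : Set ℤ) : Set ℤ := {c | 0 ≤ c ∧ c + 1 ∈ U}

theorem isShift_shift (U : Set ℤ) : IsShift U (shift U) := fun c hc => by simp [shift, hc]

section

variable {M N : ℕ} {U : Set ℤ}

theorem InvariantSet.shift (hU : InvariantSet M N U) : InvariantSet M N (shift U) := by
  refine ⟨fun c hc => hc.1, fun c hc => ⟨?_, ?_⟩, fun c hc => ⟨?_, ?_⟩, ?_⟩
  · have := hc.1; omega
  · have := hU.add_left _ hc.2; rwa [add_right_comm]
  · have := hc.1; omega
  · have := hU.add_right _ hc.2; rwa [add_right_comm]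
  · obtain ⟨B, hB⟩ := hU.cofinite
    exact ⟨max B 0, fun c hc => ⟨(le_max_right _ _).trans hc,
      hB _ (((le_max_left _ _).trans hc).trans (by omega))⟩⟩

theorem InvariantSet.unshift (hU : InvariantSet M N U) :
    InvariantSet M N {c | c - 1 ∈ U} := by
  refine ⟨fun c hc => ?_, fun c hc => ?_, fun c hc => ?_, ?_⟩
  · have := hU.nonneg _ hc; omega
  · have := hU.add_left _ hc; rwa [← add_sub_right_comm] at this
  · have := hU.add_right _ hc; rwa [← add_sub_right_comm] at this
  · obtain ⟨B, hB⟩ := hU.cofinite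
    exact ⟨B + 1, fun c hc => hB _ (by omega)⟩

theorem word_shift_eq_iff {v : List Letter} {x : Letter} :
    word (M + 1) N (shift U) = v ++ [x] ↔
      word (M + 1) N U = letter N U 0 :: v ∧ letter N U (M + 1) = x := by
  rw [(isShift_shift U).word_eq, word_succ_eq_cons, List.cons.injEq]
  constructor
  · intro h
    obtain ⟨h1, h2⟩ := List.append_inj' h rfl
    exact ⟨⟨rfl, h1⟩, List.singleton_inj.mp h2⟩
  · rintro ⟨⟨-, h1⟩, h2⟩
    rw [h1, h2]

/-- When `0 ∉ U`, the letter of cell `0` in either word only tells whether the other word's length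
is in `U`, that is, whether the other word gains a bullet. Nothing is lost, and the inverse is
translation by `+1`. -/
theorem bijOn_shift_of_zero_not_mem (v w : List Letter) (x z : Letter) :
    Set.BijOn shift
      {U | 0 ∉ U ∧ letter (N + 1) U (M + 1) = x ∧ letter (M + 1) U (N + 1) = z ∧
        U ∈ family (M + 1) (N + 1) ((if z = .bullet then .one else .zero) :: v)
          ((if x = .bullet then .one else .zero) :: w)}
      (family (M + 1) (N + 1) (v ++ [x]) (w ++ [z])) := by
  have hl : ∀ {M N : ℕ} {U : Set ℤ} {z : Letter}, 0 ∉ U → letter M U (N + 1) = z →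
      letter (N + 1) U 0 = if z = .bullet then .one else .zero := by
    intro M N U z h0 hz
    subst hz
    split_ifs with h
    · rw [letter_eq_bullet] at h
      exact letter_eq_one.mpr ⟨h0, by simpa using h⟩
    · rw [letter_eq_bullet] at h
      exact letter_eq_zero.mpr ⟨h0, by simpa using h⟩
  refine ⟨?_, ?_, ?_⟩
  · rintro U ⟨-, hx, hz, hU, hv, hw⟩
    refine ⟨hU.shift, ?_, ?_⟩
    · rw [word_shift_eq_iff, hv]
      rw [word_succ_eq_cons] at hv
      rw [(List.cons.inj hv).1]
      exact ⟨rfl, hx⟩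
    · rw [word_shift_eq_iff, hw]
      rw [word_succ_eq_cons] at hw
      rw [(List.cons.inj hw).1]
      exact ⟨rfl, hz⟩
  · rintro U ⟨h0, -, -, hU⟩ U' ⟨h0', -, -, hU'⟩ h
    have key : ∀ {V : Set ℤ}, (0 : ℤ) ∉ V → (∀ c ∈ V, 0 ≤ c) → ∀ c, c ∈ V ↔ c - 1 ∈ shift V := by
      intro V h0 hV c
      simp only [shift, Set.mem_ofPred_eq, sub_add_cancel]
      refine ⟨fun hc => ⟨?_, hc⟩, fun hc => hc.2⟩
      have := hV c hc
      have : c ≠ 0 := by rintro rfl; exact h0 hc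
      omega
    ext c
    rw [key h0 hU.1.nonneg, h, ← key h0' hU'.1.nonneg]
  · rintro U ⟨hU, hv, hw⟩
    have hsh : shift {c | c - 1 ∈ U} = U := by
      ext c
      simp only [shift, Set.mem_ofPred_eq, add_sub_cancel_right]
      exact ⟨fun h => h.2, fun h => ⟨hU.nonneg c h, h⟩⟩
    have h0 : (0 : ℤ) ∉ {c | c - 1 ∈ U} := fun h => by
      have := hU.nonneg _ h
      omega
    rw [← hsh, word_shift_eq_iff] at hv hw
    refine ⟨_, ⟨h0, hv.2, hw.2, hU.unshift, ?_, ?_⟩, hsh⟩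
    · rw [hv.1, hl h0 hw.2]
    · rw [hw.1, hl h0 hv.2]

theorem bijOn_shift_of_zero_mem (v w : List Letter) :
    Set.BijOn shift (family (M + 1) (N + 1) (.bullet :: v) (.bullet :: w))
      (family (M + 1) (N + 1) (v ++ [.bullet]) (w ++ [.bullet])) := by
  have hz : ∀ {U : Set ℤ}, U ∈ family (M + 1) (N + 1) (.bullet :: v) (.bullet :: w) →
      (0 : ℤ) ∈ U := by
    rintro U ⟨-, hv, -⟩
    rw [word_succ_eq_cons] at hv
    exact letter_eq_bullet.mp (List.cons.inj hv).1
  refine ⟨?_, ?_, ?_⟩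
  · intro U hU'
    have h0 := hz hU'
    obtain ⟨hU, hv, hw⟩ := hU'
    have hM := hU.add_left _ h0
    have hN := hU.add_right _ h0
    rw [zero_add] at hM hN
    refine ⟨hU.shift, ?_, ?_⟩
    · rw [word_shift_eq_iff, hv, letter_eq_bullet.mpr h0]
      exact ⟨rfl, letter_eq_bullet.mpr hM⟩
    · rw [word_shift_eq_iff, hw, letter_eq_bullet.mpr h0]
      exact ⟨rfl, letter_eq_bullet.mpr hN⟩
  · intro U hU U' hU' h
    ext c
    by_cases hc : 0 < c
    · have := isShift_shift U (c - 1) (by omega)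
      rw [h, isShift_shift U' (c - 1) (by omega), sub_add_cancel] at this
      exact this.symm
    · by_cases hc0 : c = 0
      · subst hc0
        exact iff_of_true (hz hU) (hz hU')
      · exact iff_of_false (fun h => by have := hU.1.nonneg c h; omega)
          (fun h => by have := hU'.1.nonneg c h; omega)
  · rintro U ⟨hU, hv, hw⟩
    have hsh : shift (insert 0 {c | c - 1 ∈ U}) = U := by
      ext c
      simp only [shift, Set.mem_ofPred_eq, add_sub_cancel_right, Set.mem_insert_iff]
      constructor
      · rintro ⟨h1, h2 | h2⟩
        · omega
        · exact h2
      · exact fun h => ⟨hU.nonneg c h, Or.inr h⟩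
    have h0 : (0 : ℤ) ∈ insert (0 : ℤ) {c | c - 1 ∈ U} := Set.mem_insert _ _
    -- The final bullets are what makes the set moved up by one remain invariant after `0` is
    -- inserted.
    have hM : (M : ℤ) ∈ U := by
      rw [word_succ_eq_append] at hv
      exact letter_eq_bullet.mp (List.singleton_inj.mp (List.append_inj' hv rfl).2)
    have hN : (N : ℤ) ∈ U := by
      rw [word_succ_eq_append] at hw
      exact letter_eq_bullet.mp (List.singleton_inj.mp (List.append_inj' hw rfl).2)
    have hI : InvariantSet (M + 1) (N + 1) (insert (0 : ℤ) {c | c - 1 ∈ U}) := by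
      have hu := hU.unshift
      refine ⟨?_, ?_, ?_, ?_⟩
      · rintro c (rfl | hc)
        exacts [le_rfl, hu.nonneg c hc]
      · rintro c (rfl | hc)
        · exact Or.inr (by simpa using hM)
        · exact Or.inr (hu.add_left c hc)
      · rintro c (rfl | hc)
        · exact Or.inr (by simpa using hN)
        · exact Or.inr (hu.add_right c hc)
      · obtain ⟨B, hB⟩ := hu.cofinite
        exact ⟨B, fun c hc => Or.inr (hB c hc)⟩
    rw [← hsh, word_shift_eq_iff, letter_eq_bullet.mpr h0] at hv hw
    exact ⟨_, ⟨hI, hv.1, hw.1⟩, hsh⟩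

end

end TorusRec

end
noncomputable section

namespace TorusRec

/-! ### Periodic sets of integers -/

/-- A set of integers that contains `0` and is invariant under translation by `k > 0`. -/
structure PeriodicSet (k : ℕ) (Z : Set ℤ) : Prop where
  pos : 0 < k
  zero_mem : (0 : ℤ) ∈ Z
  add_mem_iff : ∀ c : ℤ, c + k ∈ Z ↔ c ∈ Z

/-- The next larger element of a set of integers. -/
def next (Z : Set ℤ) (c : ℤ) : ℤ := sInf {d | d ∈ Z ∧ c < d}

/-- The next smaller element of a set of integers. -/
def prev (Z : Set ℤ) (c : ℤ) : ℤ := sSup {d | d ∈ Z ∧ d < c}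

namespace PeriodicSet

variable {k : ℕ} {Z : Set ℤ}

theorem add_mul_mem_iff (hZ : PeriodicSet k Z) (c s : ℤ) : c + k * s ∈ Z ↔ c ∈ Z := by
  induction s using Int.induction_on with
  | zero => simp
  | succ s ih => rw [← ih, ← hZ.add_mem_iff (c + k * s)]; ring_nf
  | pred s ih => rw [← ih, ← hZ.add_mem_iff (c + k * (-s - 1))]; ring_nf

theorem exists_gt (hZ : PeriodicSet k Z) (c : ℤ) : ∃ d ∈ Z, c < d := by
  have hk : (0 : ℤ) < k := by exact_mod_cast hZ.pos
  refine ⟨0 + k * (|c| + 1), (hZ.add_mul_mem_iff _ _).mpr hZ.zero_mem, ?_⟩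
  have := le_abs_self c
  have := abs_nonneg c
  nlinarith

theorem exists_lt (hZ : PeriodicSet k Z) (c : ℤ) : ∃ d ∈ Z, d < c := by
  have hk : (0 : ℤ) < k := by exact_mod_cast hZ.pos
  refine ⟨0 + k * (-|c| - 1), (hZ.add_mul_mem_iff _ _).mpr hZ.zero_mem, ?_⟩
  have := neg_abs_le c
  have := abs_nonneg c
  nlinarith

theorem next_spec (hZ : PeriodicSet k Z) (c : ℤ) : next Z c ∈ Z ∧ c < next Z c :=
  Int.csInf_mem (s := {d | d ∈ Z ∧ c < d}) (hZ.exists_gt c) ⟨c, fun _ hd => hd.2.le⟩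

theorem prev_spec (hZ : PeriodicSet k Z) (c : ℤ) : prev Z c ∈ Z ∧ prev Z c < c :=
  Int.csSup_mem (s := {d | d ∈ Z ∧ d < c}) (hZ.exists_lt c) ⟨c, fun _ hd => hd.2.le⟩

theorem next_le_iff (hZ : PeriodicSet k Z) {c d : ℤ} (hd : d ∈ Z) : next Z c ≤ d ↔ c < d :=
  ⟨fun h => (hZ.next_spec c).2.trans_le h, fun h => csInf_le ⟨c, fun _ h => h.2.le⟩ ⟨hd, h⟩⟩

theorem le_prev_iff (hZ : PeriodicSet k Z) {c d : ℤ} (hd : d ∈ Z) : d ≤ prev Z c ↔ d < c :=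
  ⟨fun h => h.trans_lt (hZ.prev_spec c).2, fun h => le_csSup ⟨c, fun _ hd => hd.2.le⟩ ⟨hd, h⟩⟩

theorem prev_next (hZ : PeriodicSet k Z) {c : ℤ} (hc : c ∈ Z) : prev Z (next Z c) = c := by
  apply le_antisymm
  · by_contra h
    have := (hZ.next_le_iff (hZ.prev_spec (next Z c)).1).mpr (not_le.mp h)
    exact (hZ.prev_spec (next Z c)).2.not_ge this
  · exact (hZ.le_prev_iff hc).mpr (hZ.next_spec c).2

theorem next_prev (hZ : PeriodicSet k Z) {c : ℤ} (hc : c ∈ Z) : next Z (prev Z c) = c := by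
  apply le_antisymm
  · exact (hZ.next_le_iff hc).mpr (hZ.prev_spec c).2
  · by_contra h
    have := (hZ.le_prev_iff (hZ.next_spec (prev Z c)).1).mpr (not_le.mp h)
    exact (hZ.next_spec (prev Z c)).2.not_ge this

/-- Strict monotonicity along `Z`, together with `next_add`, is why moving along `Z` preserves the
comparisons of `c + M` with `d` in pdinv and the Schröder path. -/
theorem next_lt_next_iff (hZ : PeriodicSet k Z) {c d : ℤ} (hd : d ∈ Z) :
    next Z c < next Z d ↔ c < d := by
  rw [← hZ.le_prev_iff (hZ.next_spec c).1, hZ.prev_next hd, hZ.next_le_iff hd]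

theorem next_add (hZ : PeriodicSet k Z) {a : ℤ} (ha : ∀ c, c + a ∈ Z ↔ c ∈ Z) (c : ℤ) :
    next Z (c + a) = next Z c + a := by
  have h1 := hZ.next_spec c
  have h2 := hZ.next_spec (c + a)
  apply le_antisymm
  · rw [hZ.next_le_iff ((ha _).mpr h1.1)]
    linarith
  · rw [← le_sub_iff_add_le, hZ.next_le_iff (by rw [← ha, sub_add_cancel]; exact h2.1)]
    linarith

theorem prev_add (hZ : PeriodicSet k Z) {a : ℤ} (ha : ∀ c, c + a ∈ Z ↔ c ∈ Z) (c : ℤ) :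
    prev Z (c + a) = prev Z c + a := by
  have h1 := hZ.prev_spec c
  have h2 := hZ.prev_spec (c + a)
  apply le_antisymm
  · rw [← sub_le_iff_le_add, hZ.le_prev_iff (by rw [← ha, sub_add_cancel]; exact h2.1)]
    linarith
  · rw [hZ.le_prev_iff ((ha _).mpr h1.1)]
    linarith

end PeriodicSet

/-! ### Invariant sets without ones in their words -/

/-- The invariant set `U` contains all nonnegative integers outside the periodic set `Z`, and
meets `Z` only from `M + N` on. -/
structure Fills (Z : Set ℤ) (M N : ℕ) (U : Set ℤ) : Prop where
  inv : InvariantSet M N U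
  left : PeriodicSet M Z
  right : PeriodicSet N Z
  mem_of_not_mem : ∀ c : ℤ, 0 ≤ c → c ∉ Z → c ∈ U
  le_of_mem : ∀ c ∈ U, c ∈ Z → (M : ℤ) + N ≤ c

/-- The set obtained by moving every element of `U ∩ Z` to the previous element of `Z`. -/
def lower (Z U : Set ℤ) : Set ℤ := {c | 0 ≤ c ∧ (c ∈ Z → next Z c ∈ U)}

/-- The set obtained by moving every element of `U ∩ Z` to the next element of `Z`. -/
def raise (Z U : Set ℤ) : Set ℤ := {c | 0 ≤ c ∧ (c ∈ Z → prev Z c ∈ U)}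

/-- The integers whose residue modulo `M + N` is below. -/
def zeroSet (M N : ℕ) (U : Set ℤ) : Set ℤ := {c | c % (M + N) ∉ U}

namespace Fills

variable {Z : Set ℤ} {M N : ℕ} {U : Set ℤ}

theorem add_add_mem_iff (h : Fills Z M N U) (c : ℤ) : c + (M + N) ∈ Z ↔ c ∈ Z := by
  rw [← add_assoc, h.right.add_mem_iff, h.left.add_mem_iff]

theorem mem_iff (h : Fills Z M N U) {c : ℤ} (hc : 0 ≤ c) (hc' : c < M + N) :
    c ∈ U ↔ c ∉ Z :=
  ⟨fun hU hZ => hc'.not_ge (h.le_of_mem c hU hZ), h.mem_of_not_mem c hc⟩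

/-- On `[0, M + N)` the complement of `U` is `Z`, and `Z` has period `M + N`; so `U` determines `Z`.
Lowering and raising therefore work along the same set. -/
theorem zeroSet_eq (h : Fills Z M N U) : zeroSet M N U = Z := by
  have hpos : (0 : ℤ) < M + N := by have := h.left.pos; omega
  ext c
  have hp : PeriodicSet (M + N) Z := ⟨by have := h.left.pos; omega, h.left.zero_mem, fun c => by
    push_cast; exact h.add_add_mem_iff c⟩
  have h1 := hp.add_mul_mem_iff (c % (M + N)) (c / (M + N))
  push_cast at h1
  rw [Int.emod_add_mul_ediv] at h1
  rw [zeroSet, Set.mem_ofPred_eq,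
    h.mem_iff (Int.emod_nonneg c hpos.ne') (Int.emod_lt_of_pos c hpos), not_not, h1]

/-- The letters only involve cells less than `M + N`, where `U` is the complement of `Z`. -/
theorem word_eq {U' : Set ℤ} (h : Fills Z M N U) (h' : Fills Z M N U') :
    word M N U = word M N U' := by
  apply List.map_congr_left
  intro i hi
  have hi' := List.mem_range.mp hi
  unfold letter
  have h1 : ((i : ℕ) : ℤ) ∈ U ↔ (i : ℤ) ∈ U' := by
    rw [h.mem_iff (by omega) (by omega), h'.mem_iff (by omega) (by omega)]
  have h2 : ((i : ℕ) : ℤ) + N ∈ U ↔ (i : ℤ) + N ∈ U' := by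
    rw [h.mem_iff (by omega) (by omega), h'.mem_iff (by omega) (by omega)]
  rw [h1, h2]

theorem symm (h : Fills Z M N U) : Fills Z N M U :=
  ⟨h.inv.symm, h.right, h.left, h.mem_of_not_mem,
    fun c hc hc' => by rw [add_comm]; exact h.le_of_mem c hc hc'⟩

theorem raise (h : Fills Z M N U) : Fills Z M N (raise Z U) := by
  refine ⟨⟨fun c hc => hc.1, fun c hc => ⟨?_, fun hc' => ?_⟩, fun c hc => ⟨?_, fun hc' => ?_⟩, ?_⟩,
    h.left, h.right, fun c hc hc' => ⟨hc, fun hcZ => absurd hcZ hc'⟩, fun c hc hc' => ?_⟩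
  · have := hc.1; omega
  · rw [h.left.prev_add h.left.add_mem_iff]
    exact h.inv.add_left _ (hc.2 ((h.left.add_mem_iff c).mp hc'))
  · have := hc.1; omega
  · rw [h.left.prev_add h.right.add_mem_iff]
    exact h.inv.add_right _ (hc.2 ((h.right.add_mem_iff c).mp hc'))
  · obtain ⟨B, hB⟩ := h.inv.cofinite
    -- Since `c - M ∈ Z`, passing to the previous element of `Z` descends by at most `M`.
    refine ⟨max 0 (B + M), fun c hc => ⟨(le_max_left _ _).trans hc, fun hcZ => hB _ ?_⟩⟩
    have h1 : c - M ≤ prev Z c := by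
      have := h.left.pos
      rw [h.left.le_prev_iff (by rw [← h.left.add_mem_iff, sub_add_cancel]; exact hcZ)]
      omega
    have := (le_max_right _ _).trans hc
    linarith
  · exact (h.le_of_mem _ (hc.2 hc') (h.left.prev_spec c).1).trans (h.left.prev_spec c).2.le

theorem add_mem (h : Fills Z M N U) : (M : ℤ) + N ∈ Z := by
  have := (h.add_add_mem_iff 0).mpr h.left.zero_mem
  rwa [zero_add] at this

theorem add_not_mem_raise (h : Fills Z M N U) : (M : ℤ) + N ∉ TorusRec.raise Z U :=
  fun hc => (h.left.prev_spec _).2.not_ge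
    (h.le_of_mem _ (hc.2 h.add_mem) (h.left.prev_spec _).1)

theorem lt_of_mem (h : Fills Z M N U) (hMN : (M : ℤ) + N ∉ U) {c : ℤ} (hc : c ∈ U)
    (hcZ : c ∈ Z) : (M : ℤ) + N < c :=
  lt_of_le_of_ne (h.le_of_mem c hc hcZ) (by rintro rfl; exact hMN hc)

theorem lower (h : Fills Z M N U) (hMN : (M : ℤ) + N ∉ U) : Fills Z M N (lower Z U) := by
  refine ⟨⟨fun c hc => hc.1, fun c hc => ⟨?_, fun hc' => ?_⟩, fun c hc => ⟨?_, fun hc' => ?_⟩, ?_⟩,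
    h.left, h.right, fun c hc hc' => ⟨hc, fun hcZ => absurd hcZ hc'⟩, fun c hc hc' => ?_⟩
  · have := hc.1; omega
  · rw [h.left.next_add h.left.add_mem_iff]
    exact h.inv.add_left _ (hc.2 ((h.left.add_mem_iff c).mp hc'))
  · have := hc.1; omega
  · rw [h.left.next_add h.right.add_mem_iff]
    exact h.inv.add_right _ (hc.2 ((h.right.add_mem_iff c).mp hc'))
  · obtain ⟨B, hB⟩ := h.inv.cofinite
    exact ⟨max 0 B, fun c hc => ⟨(le_max_left _ _).trans hc, fun hcZ =>
      hB _ (((le_max_right _ _).trans hc).trans (h.left.next_spec c).2.le)⟩⟩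
  · have := h.lt_of_mem hMN (hc.2 hc') (h.left.next_spec c).1
    by_contra hlt
    exact this.not_ge ((h.left.next_le_iff h.add_mem).mpr (not_le.mp hlt))

theorem lower_raise (h : Fills Z M N U) : TorusRec.lower Z (TorusRec.raise Z U) = U := by
  ext c
  constructor
  · rintro ⟨hc, hc'⟩
    by_cases hcZ : c ∈ Z
    · have := (hc' hcZ).2 (h.left.next_spec c).1
      rwa [h.left.prev_next hcZ] at this
    · exact h.mem_of_not_mem c hc hcZ
  · intro hc
    have h0 := h.inv.nonneg c hc
    refine ⟨h0, fun hcZ => ⟨h0.trans (h.left.next_spec c).2.le, fun _ => ?_⟩⟩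
    rwa [h.left.prev_next hcZ]

theorem raise_lower (h : Fills Z M N U) : TorusRec.raise Z (TorusRec.lower Z U) = U := by
  ext c
  constructor
  · rintro ⟨hc, hc'⟩
    by_cases hcZ : c ∈ Z
    · have := (hc' hcZ).2 (h.left.prev_spec c).1
      rwa [h.left.next_prev hcZ] at this
    · exact h.mem_of_not_mem c hc hcZ
  · intro hc
    have h0 := h.inv.nonneg c hc
    refine ⟨h0, fun hcZ => ⟨?_, fun _ => ?_⟩⟩
    · rw [h.left.le_prev_iff h.left.zero_mem]
      have := h.le_of_mem c hc hcZ
      have := h.left.pos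
      omega
    · rwa [h.left.next_prev hcZ]

theorem not_mem_lower_iff {c : ℤ} (hc : 0 ≤ c) :
    c ∉ TorusRec.lower Z U ↔ c ∈ Z ∧ next Z c ∉ U := by
  simp [TorusRec.lower, hc]

theorem mem_of_nonneg_of_not_mem (h : Fills Z M N U) {c : ℤ} (hc : 0 ≤ c) (hcU : c ∉ U) :
    c ∈ Z := by
  by_contra hcZ
  exact hcU (h.mem_of_not_mem c hc hcZ)

theorem mem_of_mem_northSet (h : Fills Z M N U) {c : ℤ} (hc : c ∈ northSet N U) : c ∈ Z :=
  h.mem_of_nonneg_of_not_mem hc.1 hc.2.1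

/-- There are no basement north steps. Hence the boundary conditions at `0` and `M`, which moving
along `Z` need not respect, never matter. -/
theorem le_of_mem_northSet (h : Fills Z M N U) {c : ℤ} (hc : c ∈ northSet N U) : (M : ℤ) ≤ c := by
  have := h.le_of_mem _ hc.2.2 ((h.right.add_mem_iff c).mpr (h.mem_of_mem_northSet hc))
  linarith

theorem image_northSet_lower (h : Fills Z M N U) (hMN : (M : ℤ) + N ∉ U) :
    next Z '' northSet N (TorusRec.lower Z U) = northSet N U := by
  ext c
  constructor
  · rintro ⟨c, ⟨hc, hc1, hc2⟩, rfl⟩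
    obtain ⟨hcZ, hcU⟩ := (not_mem_lower_iff hc).mp hc1
    refine ⟨hc.trans (h.left.next_spec c).2.le, hcU, ?_⟩
    rw [← h.left.next_add h.right.add_mem_iff]
    exact hc2.2 ((h.right.add_mem_iff c).mpr hcZ)
  · intro hc
    have hcZ := h.mem_of_mem_northSet hc
    have hcNZ := (h.right.add_mem_iff c).mpr hcZ
    have h1 := h.lt_of_mem hMN hc.2.2 hcNZ
    have h0 : 0 ≤ prev Z c := by
      rw [h.left.le_prev_iff h.left.zero_mem]
      omega
    refine ⟨prev Z c, ⟨h0, ?_, ?_, fun _ => ?_⟩, h.left.next_prev hcZ⟩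
    · rw [not_mem_lower_iff h0, h.left.next_prev hcZ]
      exact ⟨(h.left.prev_spec c).1, hc.2.1⟩
    · omega
    · rw [h.left.next_add h.right.add_mem_iff, h.left.next_prev hcZ]
      exact hc.2.2

/-- `M + N` is the smallest element of `Z` in the area range, hence the only area cell that is not
the successor of another. -/
theorem areaSet_eq (h : Fills Z M N U) (hMN : (M : ℤ) + N ∉ U) :
    areaSet M N U = insert ((M : ℤ) + N) (next Z '' areaSet M N (TorusRec.lower Z U)) := by
  ext c
  simp only [Set.mem_insert_iff, Set.mem_image]
  constructor
  · rintro ⟨hc, hcU⟩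
    rcases hc.eq_or_lt with h1 | h1
    · exact Or.inl h1.symm
    · have hcZ := h.mem_of_nonneg_of_not_mem (by omega) hcU
      have h2 := (h.left.le_prev_iff h.add_mem).mpr h1
      refine Or.inr ⟨prev Z c, ⟨h2, ?_⟩, h.left.next_prev hcZ⟩
      rw [not_mem_lower_iff (by omega), h.left.next_prev hcZ]
      exact ⟨(h.left.prev_spec c).1, hcU⟩
  · rintro (rfl | ⟨c, ⟨hc, hc1⟩, rfl⟩)
    · exact ⟨le_rfl, hMN⟩
    · exact ⟨hc.trans (h.left.next_spec c).2.le, ((not_mem_lower_iff (by omega)).mp hc1).2⟩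

theorem next_injOn (h : Fills Z M N U) : Set.InjOn (next Z) Z := fun c hc d hd hcd => by
  rw [← h.left.prev_next hc, hcd, h.left.prev_next hd]

theorem ncard_areaSet (h : Fills Z M N U) (hMN : (M : ℤ) + N ∉ U) :
    (areaSet M N U).ncard = (areaSet M N (TorusRec.lower Z U)).ncard + 1 := by
  have hfin : (areaSet M N (TorusRec.lower Z U)).Finite := (h.lower hMN).inv.finite_compl _
  rw [h.areaSet_eq hMN, Set.ncard_insert_of_notMem _ (hfin.image _), Set.InjOn.ncard_image]
  · exact h.next_injOn.mono fun c hc =>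
      (h.lower hMN).mem_of_nonneg_of_not_mem (by have := hc.1; omega) hc.2
  · rintro ⟨c, hc, hc'⟩
    have := (h.left.next_spec c).2
    rw [hc'] at this
    exact this.not_ge hc.1

theorem ncard_pdinvSet (h : Fills Z M N U) (hMN : (M : ℤ) + N ∉ U) :
    (pdinvSet M N U).ncard = (pdinvSet M N (TorusRec.lower Z U)).ncard := by
  have hl := h.lower hMN
  have hmem : ∀ {cd : ℤ × ℤ}, cd ∈ pdinvSet M N (TorusRec.lower Z U) → cd.1 ∈ Z ∧ cd.2 ∈ Z :=
    fun hcd => ⟨hl.mem_of_mem_northSet hcd.2.2.2.1,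
      hl.mem_of_nonneg_of_not_mem (by have := hcd.2.1; omega) hcd.2.2.2.2⟩
  have himg : pdinvSet M N U = (Prod.map (next Z) (next Z)) ''
      pdinvSet M N (TorusRec.lower Z U) := by
    ext ⟨c, d⟩
    constructor
    · rintro ⟨h1, h2, h3, h4, h5⟩
      simp only at h1 h2 h3 h4 h5
      have hdZ : d ∈ Z := h.mem_of_nonneg_of_not_mem (by omega) h5
      rw [← h.image_northSet_lower hMN] at h4
      obtain ⟨c, hc, rfl⟩ := h4
      have hcZ := hl.mem_of_mem_northSet hc
      obtain ⟨d, hd', rfl⟩ : ∃ d' ∈ Z, next Z d' = d :=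
        ⟨prev Z d, (h.left.prev_spec d).1, h.left.next_prev hdZ⟩
      rw [h.left.next_lt_next_iff hd'] at h1
      rw [← h.left.next_add h.left.add_mem_iff,
        h.left.next_lt_next_iff ((h.left.add_mem_iff c).mpr hcZ)] at h3
      -- The condition `M ≤ d` follows from `M ≤ c < d`.
      have h6 := hl.le_of_mem_northSet hc
      refine ⟨(c, d), ⟨h1, h6.trans h1.le, h3, hc, ?_⟩, rfl⟩
      exact (not_mem_lower_iff (by simp only; omega)).mpr ⟨hd', h5⟩
    · rintro ⟨⟨c, d⟩, hcd, hh⟩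
      obtain ⟨hcZ, hdZ⟩ := hmem hcd
      obtain ⟨h1, h2, h3, h4, h5⟩ := hcd
      simp only [Prod.map_apply, Prod.mk.injEq] at hh h1 h2 h3 h4 h5 hcZ hdZ
      obtain ⟨rfl, rfl⟩ := hh
      refine ⟨(h.left.next_lt_next_iff hdZ).mpr h1, h2.trans (h.left.next_spec d).2.le, ?_, ?_,
        ((not_mem_lower_iff (by omega)).mp h5).2⟩
      · simp only
        rw [← h.left.next_add h.left.add_mem_iff]
        exact (h.left.next_lt_next_iff ((h.left.add_mem_iff c).mpr hcZ)).mpr h3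
      · rw [← h.image_northSet_lower hMN]
        exact ⟨c, h4, rfl⟩
  rw [himg, Set.InjOn.ncard_image]
  rintro ⟨c, d⟩ hcd ⟨c', d'⟩ hcd' heq
  simp only [Prod.map_apply, Prod.mk.injEq] at heq
  exact Prod.ext (h.next_injOn (hmem hcd).1 (hmem hcd').1 heq.1)
    (h.next_injOn (hmem hcd).2 (hmem hcd').2 heq.2)

theorem steps_eq (h : Fills Z M N U) (hMN : (M : ℤ) + N ∉ U) :
    steps M N U = steps M N (TorusRec.lower Z U) := by
  have hl := h.lower hMN
  have hfin := hl.inv.finite_northSet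
  have hmem : ∀ c ∈ sortedList (northSet N (TorusRec.lower Z U)), c ∈ Z ∧ (M : ℤ) ≤ c := by
    intro c hc
    rw [mem_sortedList hfin] at hc
    exact ⟨hl.mem_of_mem_northSet hc, hl.le_of_mem_northSet hc⟩
  rw [steps, steps, ← h.image_northSet_lower hMN, sortedList_image hfin fun a _ b hb hab =>
    (h.left.next_lt_next_iff (hl.mem_of_mem_northSet hb)).mpr hab]
  generalize sortedList (northSet N (TorusRec.lower Z U)) = cs at *
  rw [schroeder, schroeder, countBelow_map (b := M) cs, schroederFrom_map]
  · intro c hc d _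
    rw [← h.left.next_add h.left.add_mem_iff]
    exact h.left.next_lt_next_iff ((h.left.add_mem_iff c).mpr (hmem c hc).1)
  · intro c hc
    rw [← h.left.next_add h.left.add_mem_iff, List.mem_map]
    constructor
    · rintro ⟨a, ha, ha'⟩
      rwa [← h.next_injOn (hmem a ha).1 ((h.left.add_mem_iff c).mpr (hmem c hc).1) ha']
    · exact fun h => ⟨_, h, rfl⟩
  · intro c hc
    have h1 := (hmem c hc).2
    have h2 := (h.left.next_spec c).2
    constructor <;> intro h3 <;> omega

end Fills

/-! ### The periodic set of a pair of words without ones -/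

section

variable {M N : ℕ} {U : Set ℤ}

theorem add_not_mem_of_ones_word_eq_zero (h : ones (word M N U) = 0) {c : ℤ} (hc : 0 ≤ c)
    (hc' : c < M) (hcU : c ∉ U) : c + N ∉ U := by
  intro hcN
  rw [ones, List.count_eq_zero] at h
  apply h
  simp only [word, List.mem_map, List.mem_range]
  refine ⟨c.toNat, by omega, ?_⟩
  rw [Int.toNat_of_nonneg hc]
  exact letter_eq_one.mpr ⟨hcU, hcN⟩

/-- Modulo `M + N`, adding `N` sends a residue `r < M` to `r + N` and any other to `r - M`.
Invariance of `U` gives one direction of each equivalence, and the absence of ones in the two words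
gives the other. Period `M` follows, as `M ≡ -N`. -/
theorem InvariantSet.fills (hU : InvariantSet M N U) (hM : 0 < M) (hN : 0 < N) (h0 : (0 : ℤ) ∉ U)
    (hv : ones (word M N U) = 0) (hw : ones (word N M U) = 0) :
    Fills (zeroSet M N U) M N U := by
  have hpos : (0 : ℤ) < M + N := by omega
  have hright : ∀ c : ℤ, c + N ∈ zeroSet M N U ↔ c ∈ zeroSet M N U := by
    intro c
    simp only [zeroSet, Set.mem_ofPred_eq]
    rw [← Int.emod_add_emod]
    have h1 := Int.emod_nonneg c hpos.ne'
    have h2 := Int.emod_lt_of_pos c hpos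
    generalize c % ((M : ℤ) + N) = r at *
    by_cases hr : r < M
    · rw [Int.emod_eq_of_lt (by omega) (by omega)]
      exact ⟨fun h h' => h (hU.add_right _ h'),
        fun h => add_not_mem_of_ones_word_eq_zero hv h1 hr h⟩
    · rw [show r + (N : ℤ) = (r - M) + (M + N) by ring, Int.add_emod_right,
        Int.emod_eq_of_lt (by omega) (by omega)]
      refine ⟨fun h => ?_, fun h h' => h ?_⟩
      · have := add_not_mem_of_ones_word_eq_zero hw (by omega) (by omega) h
        rwa [sub_add_cancel] at this
      · have := hU.add_left _ h'
        rwa [sub_add_cancel] at this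
  have hz : (0 : ℤ) ∈ zeroSet M N U := by simpa [zeroSet] using h0
  refine ⟨hU, ⟨hM, hz, fun c => ?_⟩, ⟨hN, hz, hright⟩, fun c hc hcZ => ?_, fun c hc hcZ => ?_⟩
  · rw [← hright]
    simp only [zeroSet, Set.mem_ofPred_eq]
    rw [add_assoc, Int.add_emod_right]
  · simp only [zeroSet, Set.mem_ofPred_eq, not_not] at hcZ
    have h1 := add_mul_mem (a := (M : ℤ) + N)
      (fun c hc => by rw [← add_assoc]; exact hU.add_right _ (hU.add_left _ hc)) hcZ
      (Int.ediv_nonneg hc hpos.le)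
    rwa [Int.emod_add_mul_ediv] at h1
  · by_contra hlt
    apply hcZ
    rwa [Int.emod_eq_of_lt (hU.nonneg c hc) (not_le.mp hlt)]

theorem fills_of_mem_family {v w : List Letter} (hM : 0 < M) (hN : 0 < N) (hv : ones v = 0)
    (hw : ones w = 0) (hU : U ∈ family M N (.zero :: v) (.zero :: w)) :
    Fills (zeroSet M N U) M N U := by
  obtain ⟨hU, hv', hw'⟩ := hU
  refine hU.fills hM hN ?_ ?_ ?_
  · obtain ⟨M, rfl⟩ := Nat.exists_eq_succ_of_ne_zero hM.ne'
    rw [Nat.succ_eq_add_one, word_succ_eq_cons] at hv'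
    exact (letter_eq_zero.mp (List.cons.inj hv').1).1
  · rw [hv']; simpa [ones] using hv
  · rw [hw']; simpa [ones] using hw

theorem bijOn_lower (v w : List Letter) (hM : 0 < M) (hN : 0 < N) (hv : ones v = 0)
    (hw : ones w = 0) :
    Set.BijOn (fun U => lower (zeroSet M N U) U)
      {U | (M : ℤ) + N ∉ U ∧ U ∈ family M N (.zero :: v) (.zero :: w)}
      (family M N (.zero :: v) (.zero :: w)) := by
  have hfam : ∀ {Z U U' : Set ℤ}, Fills Z M N U → Fills Z M N U' →
      U ∈ family M N (.zero :: v) (.zero :: w) → U' ∈ family M N (.zero :: v) (.zero :: w) :=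
    fun h h' hU => ⟨h'.inv, (h'.word_eq h).trans hU.2.1, (h'.symm.word_eq h.symm).trans hU.2.2⟩
  refine Set.InvOn.bijOn (f' := fun U => raise (zeroSet M N U) U) ⟨?_, ?_⟩ ?_ ?_
  · rintro U ⟨hMN, hU⟩
    have h := fills_of_mem_family hM hN hv hw hU
    simp only
    rw [(h.lower hMN).zeroSet_eq, h.raise_lower]
  · intro U hU
    have h := fills_of_mem_family hM hN hv hw hU
    simp only
    rw [h.raise.zeroSet_eq, h.lower_raise]
  · rintro U ⟨hMN, hU⟩
    have h := fills_of_mem_family hM hN hv hw hU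
    exact hfam h (h.lower hMN) hU
  · intro U hU
    have h := fills_of_mem_family hM hN hv hw hU
    exact ⟨h.add_not_mem_raise, hfam h h.raise hU⟩

/-- This replaces the shift in the branch `M + N ∉ U` and makes the left side of (2) reappear on the
right, multiplied by `q`. -/
theorem gen_eq_X_mul_of_ones_eq_zero {K : Type*} [Field K] (t : K) (v w : List Letter)
    (hM : 0 < M) (hN : 0 < N) (hv : ones v = 0) (hw : ones w = 0) :
    gen t 0 M N {U | (M : ℤ) + N ∉ U ∧ U ∈ family M N (.zero :: v) (.zero :: w)}
      = PowerSeries.X * gen t 0 M N (family M N (.zero :: v) (.zero :: w)) := by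
  rw [gen_eq_of_bijOn hM t (bijOn_lower v w hM hN hv hw) (fun U hU => hU.1) LinearMap.id 1
    (fun U hU => (fills_of_mem_family hM hN hv hw hU.2).ncard_areaSet hU.1) (fun U hU => ?_),
    qExt_id, pow_one]
  have h := fills_of_mem_family hM hN hv hw hU.2
  rw [LinearMap.id_apply, weight, weight, h.ncard_pdinvSet hU.1, h.steps_eq hU.1]

end

end TorusRec

end
noncomputable section

namespace TorusRec

/-! ### The recursion -/

section

variable {K : Type*} [Field K] {M N : ℕ} {U U' : Set ℤ} {v w : List Letter} {x z : Letter}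

theorem evalSteps_vertical (t : K) (l : ℕ) (S : List Step) :
    evalSteps t l (.vertical :: S) = dMinus t l (evalSteps t (l + 1) S) := by
  cases l <;> rfl

theorem weight_eq {t : K} (ht : t ≠ 0) {l l' j : ℕ} {d : V K l' →ₗ[K] V K l}
    (hp : (pdinvSet M N U).ncard = (pdinvSet M N U').ncard + j)
    (hs : evalSteps t l (steps M N U) = d (evalSteps t l' (steps M N U'))) :
    weight t l M N U = (t ^ (-(j : ℤ)) • d) (weight t l' M N U') := by
  rw [weight, weight, hp, hs, LinearMap.smul_apply, map_smul, smul_smul, ← zpow_add₀ ht]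
  push_cast
  ring_nf

theorem letter_zero_of_mem_family (hU : U ∈ family (M + 1) (N + 1) (x :: v) (z :: w)) :
    letter (N + 1) U 0 = x ∧ letter (M + 1) U 0 = z := by
  obtain ⟨-, hv, hw⟩ := hU
  rw [word_succ_eq_cons] at hv hw
  exact ⟨(List.cons.inj hv).1, (List.cons.inj hw).1⟩

theorem ncard_pdinvSet_of_mem_family (hU : U ∈ family (M + 1) (N + 1) (x :: v) (z :: w)) :
    (pdinvSet (M + 1) (N + 1) U).ncard = (pdinvSet (M + 1) (N + 1) (shift U)).ncard +
      open Classical in if ((M + 1 : ℕ) : ℤ) ∈ U then 0 else ones v := by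
  obtain ⟨hU, hv, -⟩ := hU
  rw [word_succ_eq_cons] at hv
  rw [(isShift_shift U).ncard_pdinvSet hU, ← (List.cons.inj hv).2, ones_map_letter]

theorem gen_shift {t : K} (ht : t ≠ 0) {l l' : ℕ} (j e : ℕ) (d : V K l' →ₗ[K] V K l)
    {A A' : Set (Set ℤ)} (hA : Set.BijOn shift A A')
    (hAf : A ⊆ family (M + 1) (N + 1) (x :: v) (z :: w))
    (he : ∀ U ∈ A, (open Classical in
      if ((M + 1 : ℕ) : ℤ) + (N + 1 : ℕ) ∈ U then 0 else 1) = e)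
    (hj : ∀ U ∈ A, (open Classical in if ((M + 1 : ℕ) : ℤ) ∈ U then 0 else ones v) = j)
    (hs : ∀ U ∈ A, evalSteps t l (steps (M + 1) (N + 1) U)
      = d (evalSteps t l' (steps (M + 1) (N + 1) (shift U)))) :
    gen t l (M + 1) (N + 1) A
      = PowerSeries.X ^ e * t ^ (-(j : ℤ)) • qExt d (gen t l' (M + 1) (N + 1) A') := by
  rw [← qExt_smul]
  refine gen_eq_of_bijOn M.succ_pos t hA ?_ _ e (fun U hU => ?_) fun U hU => ?_
  · intro U' hU'
    obtain ⟨U, hU, rfl⟩ := hA.surjOn hU'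
    exact (hAf hU).1.shift
  · rw [(isShift_shift U).ncard_areaSet (hAf hU).1 (by omega), he U hU]
  · refine weight_eq ht ?_ (hs U hU)
    rw [ncard_pdinvSet_of_mem_family (hAf hU), hj U hU]

theorem mem_northSet_iff_letter_eq_one {c : ℤ} (hc : 0 ≤ c) :
    c ∈ northSet N U ↔ letter N U c = .one := by
  rw [letter_eq_one]
  exact ⟨fun h => h.2, fun h => ⟨hc, h⟩⟩

theorem zero_not_mem_of_mem_family {z : Letter}
    (hU : U ∈ family (M + 1) (N + 1) (x :: v) (z :: w)) (hx : x ≠ .bullet) : (0 : ℤ) ∉ U :=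
  fun h => hx ((letter_zero_of_mem_family hU).1.symm.trans (letter_eq_bullet.mpr h))

theorem gen_bullet_bullet {t : K} (ht : t ≠ 0) (l : ℕ) :
    gen t l (M + 1) (N + 1) (family (M + 1) (N + 1) (.bullet :: v) (.bullet :: w))
      = gen t l (M + 1) (N + 1)
          (family (M + 1) (N + 1) (v ++ [.bullet]) (w ++ [.bullet])) := by
  have h0 : ∀ U ∈ family (M + 1) (N + 1) (.bullet :: v) (.bullet :: w), (0 : ℤ) ∈ U :=
    fun U hU => letter_eq_bullet.mp (letter_zero_of_mem_family hU).1
  have hM : ∀ U ∈ family (M + 1) (N + 1) (.bullet :: v) (.bullet :: w),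
      ((M + 1 : ℕ) : ℤ) ∈ U := fun U hU => by simpa using hU.1.add_left _ (h0 U hU)
  have h := gen_shift ht 0 0 (LinearMap.id : V K l →ₗ[K] V K l) (bijOn_shift_of_zero_mem v w)
    subset_rfl (fun U hU => if_pos (hU.1.add_right _ (hM U hU))) (fun U hU => if_pos (hM U hU))
    (fun U hU => by
      rw [LinearMap.id_apply, (isShift_shift U).steps_eq hU.1.shift (fun h => h.2.1 (h0 U hU))
        (fun h => h.2.1 (hM U hU))])
  simpa [qExt_id] using h

/-- The common form of (2)–(6): `x'` and `z'` are the letters of the cells `M + 1` and `N + 1`, the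
word lengths being `M + 1` and `N + 1`. They force the first letters `x` and `z`, the exponent `e`
of `q` and the exponent `j` of `t⁻¹`; only the step removed from the Schröder path remains to be
given in `hs`. -/
theorem gen_of_ne_bullet {t : K} (ht : t ≠ 0) {l l' : ℕ} (j e : ℕ) (d : V K l' →ₗ[K] V K l)
    (x' z' : Letter) (hx : (if z' = .bullet then Letter.one else .zero) = x)
    (hz : (if x' = .bullet then Letter.one else .zero) = z)
    (he : (if x' = .zero ∨ z' = .zero then 1 else 0) = e)
    (hj : (if x' = .bullet then 0 else ones v) = j)
    (hs : ∀ U ∈ family (M + 1) (N + 1) (x :: v) (z :: w),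
      letter (N + 1) U (M + 1 : ℕ) = x' → letter (N + 1) U 0 = x →
      evalSteps t l (steps (M + 1) (N + 1) U)
        = d (evalSteps t l' (steps (M + 1) (N + 1) (shift U)))) :
    gen t l (M + 1) (N + 1) {U | letter (N + 1) U (M + 1 : ℕ) = x' ∧
        letter (M + 1) U (N + 1 : ℕ) = z' ∧ U ∈ family (M + 1) (N + 1) (x :: v) (z :: w)}
      = PowerSeries.X ^ e * t ^ (-(j : ℤ)) • qExt d (gen t l' (M + 1) (N + 1)
          (family (M + 1) (N + 1) (v ++ [x']) (w ++ [z']))) := by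
  have hxb : x ≠ .bullet := by rw [← hx]; split_ifs <;> simp
  have hA : {U | letter (N + 1) U (M + 1 : ℕ) = x' ∧
        letter (M + 1) U (N + 1 : ℕ) = z' ∧ U ∈ family (M + 1) (N + 1) (x :: v) (z :: w)} =
      {U | 0 ∉ U ∧ letter (N + 1) U (M + 1) = x' ∧ letter (M + 1) U (N + 1) = z' ∧
        U ∈ family (M + 1) (N + 1) ((if z' = .bullet then .one else .zero) :: v)
          ((if x' = .bullet then .one else .zero) :: w)} := by
    ext U
    rw [hx, hz]
    push_cast
    exact ⟨fun h => ⟨zero_not_mem_of_mem_family h.2.2 hxb, h⟩, fun h => h.2⟩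
  refine gen_shift ht j e d (hA ▸ bijOn_shift_of_zero_not_mem v w x' z') (fun U hU => hU.2.2)
    ?_ ?_ ?_
  · rintro U ⟨hx', hz', hU⟩
    rw [← he]
    -- If the sum of the two lengths is not in `U`, neither length is, so both new letters are `0`;
    -- a single new letter `0` conversely excludes the sum.
    have h1 : (((M + 1 : ℕ) : ℤ) + (N + 1 : ℕ) ∈ U) ↔ ¬ (x' = .zero ∨ z' = .zero) := by
      rw [← hx', ← hz', letter_eq_zero, letter_eq_zero]
      have h2 := hU.1.add_right ((M + 1 : ℕ) : ℤ)
      have h3 := hU.1.add_left ((N + 1 : ℕ) : ℤ)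
      rw [add_comm ((N + 1 : ℕ) : ℤ)] at h3 ⊢
      tauto
    simp only [h1]
    split_ifs <;> tauto
  · rintro U ⟨hx', hz', hU⟩
    rw [← hj, ← hx']
    classical exact if_congr letter_eq_bullet.symm rfl rfl
  · rintro U ⟨hx', hz', hU⟩
    exact hs U hU hx' (letter_zero_of_mem_family hU).1

theorem steps_eq_of_letter (hU : U ∈ family (M + 1) (N + 1) (x :: v) (z :: w)) {x' : Letter}
    (hx' : letter (N + 1) U (M + 1 : ℕ) = x') (hx : x ≠ .one) (hx1 : x' ≠ .one) :
    steps (M + 1) (N + 1) U = steps (M + 1) (N + 1) (shift U) := by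
  refine (isShift_shift U).steps_eq hU.1.shift ?_ ?_
  · rwa [mem_northSet_iff_letter_eq_one le_rfl, (letter_zero_of_mem_family hU).1]
  · rwa [mem_northSet_iff_letter_eq_one (by omega), hx']

theorem letter_of_mem_family (hU : U ∈ family (M + 1) (N + 1) (x :: v) (z :: w))
    (hx : x ≠ .bullet) :
    (letter (M + 1) U (N + 1 : ℕ) = .bullet ↔ x = .one) ∧
    (letter (N + 1) U (M + 1 : ℕ) = .bullet ↔ z = .one) := by
  have h0 := zero_not_mem_of_mem_family hU hx
  obtain ⟨h1, h2⟩ := letter_zero_of_mem_family hU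
  rw [← h1, ← h2, letter_eq_one, letter_eq_one, letter_eq_bullet, letter_eq_bullet, zero_add,
    zero_add]
  exact ⟨⟨fun h => ⟨h0, h⟩, fun h => h.2⟩, ⟨fun h => ⟨h0, h⟩, fun h => h.2⟩⟩

theorem add_mem_of_letter (hU : InvariantSet M N U) (h : letter N U M = .bullet) :
    (N : ℤ) + M ∈ U := by
  rw [add_comm]
  exact hU.add_right _ (letter_eq_bullet.mp h)

theorem gen_one_zero {t : K} (ht : t ≠ 0) (l : ℕ) (hv : ones v = l) :
    gen t (l + 1) (M + 1) (N + 1) (family (M + 1) (N + 1) (.one :: v) (.zero :: w))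
      = t ^ (-(l : ℤ)) • qExt (dEq t l) (gen t (l + 1) (M + 1) (N + 1)
          (family (M + 1) (N + 1) (v ++ [.one]) (w ++ [.bullet]))) := by
  have h := gen_of_ne_bullet (M := M) (N := N) (v := v) (w := w) (x := .one) (z := .zero) ht l 0
    (dEq t l) .one .bullet rfl rfl rfl hv (fun U hU h1 h2 => by
      rw [(isShift_shift U).steps_eq_diagonal M.succ_pos hU.1 hU.1.shift
        ((mem_northSet_iff_letter_eq_one le_rfl).mpr h2)
        ((mem_northSet_iff_letter_eq_one (by omega)).mpr h1)]
      rfl)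
  rw [pow_zero, one_mul] at h
  rw [← h]
  congr 1
  ext U
  -- The first letters already determine both new letters: cell `N + 1` is above, hence so is the
  -- sum of the lengths, while cell `M + 1` is below.
  refine ⟨fun hU => ?_, fun hU => hU.2.2⟩
  obtain ⟨h1, h2⟩ := letter_of_mem_family hU (by simp)
  have h3 := h1.mpr rfl
  refine ⟨letter_eq_one.mpr ⟨?_, ?_⟩, h3, hU⟩
  · rw [← letter_eq_bullet (N := N + 1), h2]; simp
  · exact add_mem_of_letter hU.1.symm h3

theorem gen_zero_one {t : K} (ht : t ≠ 0) (l : ℕ) :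
    gen t l (M + 1) (N + 1) (family (M + 1) (N + 1) (.zero :: v) (.one :: w))
      = gen t l (M + 1) (N + 1)
          (family (M + 1) (N + 1) (v ++ [.bullet]) (w ++ [.one])) := by
  have h := gen_of_ne_bullet (M := M) (N := N) (v := v) (w := w) (x := .zero) (z := .one) ht 0 0
    (LinearMap.id : V K l →ₗ[K] V K l) .bullet .one rfl rfl rfl rfl (fun U hU h1 h2 => by
      rw [steps_eq_of_letter hU h1 (by simp) (by simp)]
      rfl)
  rw [pow_zero, one_mul, Nat.cast_zero, neg_zero, zpow_zero, one_smul, qExt_id] at h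
  rw [← h]
  congr 1
  ext U
  refine ⟨fun hU => ?_, fun hU => hU.2.2⟩
  obtain ⟨h1, h2⟩ := letter_of_mem_family hU (by simp)
  have h3 := h2.mpr rfl
  refine ⟨h3, letter_eq_one.mpr ⟨?_, ?_⟩, hU⟩
  · rw [← letter_eq_bullet (N := M + 1), h1]; simp
  · exact add_mem_of_letter hU.1 h3

theorem gen_one_one {t : K} (ht : t ≠ 0) (l : ℕ) :
    gen t (l + 1) (M + 1) (N + 1) (family (M + 1) (N + 1) (.one :: v) (.one :: w))
      = qExt (dPlus t l) (gen t l (M + 1) (N + 1)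
          (family (M + 1) (N + 1) (v ++ [.bullet]) (w ++ [.bullet]))) := by
  have h := gen_of_ne_bullet (M := M) (N := N) (v := v) (w := w) (x := .one) (z := .one) ht 0 0
    (dPlus t l) .bullet .bullet rfl rfl rfl rfl (fun U hU h1 h2 => by
      rw [(isShift_shift U).steps_eq_horizontal M.succ_pos hU.1 hU.1.shift
        ((mem_northSet_iff_letter_eq_one le_rfl).mpr h2)
        ((mem_northSet_iff_letter_eq_one (by omega)).not.mpr (by rw [h1]; simp))]
      rfl)
  rw [pow_zero, one_mul, Nat.cast_zero, neg_zero, zpow_zero, one_smul] at h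
  rw [← h]
  congr 1
  ext U
  refine ⟨fun hU => ?_, fun hU => hU.2.2⟩
  obtain ⟨h1, h2⟩ := letter_of_mem_family hU (by simp)
  exact ⟨h2.mpr rfl, h1.mpr rfl, hU⟩

theorem letter_eq_one_of_mem_family
    (hU : U ∈ family (M + 1) (N + 1) (.zero :: v) (.zero :: w))
    (hMN : ((M + 1 : ℕ) : ℤ) + (N + 1 : ℕ) ∈ U) :
    letter (N + 1) U (M + 1 : ℕ) = .one ∧ letter (M + 1) U (N + 1 : ℕ) = .one := by
  obtain ⟨h1, h2⟩ := letter_of_mem_family hU (by simp)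
  simp only [letter_eq_bullet, reduceCtorEq, iff_false] at h1 h2
  exact ⟨letter_eq_one.mpr ⟨h2, hMN⟩, letter_eq_one.mpr ⟨h1, by rwa [add_comm]⟩⟩

theorem letter_eq_zero_of_mem_family
    (hU : U ∈ family (M + 1) (N + 1) (.zero :: v) (.zero :: w))
    (hMN : ((M + 1 : ℕ) : ℤ) + (N + 1 : ℕ) ∉ U) :
    letter (N + 1) U (M + 1 : ℕ) = .zero ∧ letter (M + 1) U (N + 1 : ℕ) = .zero := by
  obtain ⟨h1, h2⟩ := letter_of_mem_family hU (by simp)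
  simp only [letter_eq_bullet, reduceCtorEq, iff_false] at h1 h2
  exact ⟨letter_eq_zero.mpr ⟨h2, hMN⟩, letter_eq_zero.mpr ⟨h1, by rwa [add_comm]⟩⟩

theorem gen_zero_zero_of_add_mem {t : K} (ht : t ≠ 0) (l : ℕ) (hv : ones v = l) :
    gen t l (M + 1) (N + 1) {U | ((M + 1 : ℕ) : ℤ) + (N + 1 : ℕ) ∈ U ∧
        U ∈ family (M + 1) (N + 1) (.zero :: v) (.zero :: w)}
      = t ^ (-(l : ℤ)) • qExt (dMinus t l) (gen t (l + 1) (M + 1) (N + 1)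
          (family (M + 1) (N + 1) (v ++ [.one]) (w ++ [.one]))) := by
  have h := gen_of_ne_bullet (M := M) (N := N) (v := v) (w := w) (x := .zero) (z := .zero) ht l 0
    (dMinus t l) .one .one rfl rfl rfl hv (fun U hU h1 h2 => by
      rw [(isShift_shift U).steps_eq_vertical hU.1 hU.1.shift
        ((mem_northSet_iff_letter_eq_one le_rfl).not.mpr (by rw [h2]; simp))
        ((mem_northSet_iff_letter_eq_one (by omega)).mpr h1), evalSteps_vertical])
  rw [pow_zero, one_mul] at h
  rw [← h]
  congr 1
  ext U
  constructor
  · rintro ⟨hMN, hU⟩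
    obtain ⟨h1, h2⟩ := letter_eq_one_of_mem_family hU hMN
    exact ⟨h1, h2, hU⟩
  · rintro ⟨h1, -, hU⟩
    exact ⟨(letter_eq_one.mp h1).2, hU⟩

theorem gen_zero_zero_of_add_not_mem {t : K} (ht : t ≠ 0) (l : ℕ) (hv : ones v = l) :
    gen t l (M + 1) (N + 1) {U | ((M + 1 : ℕ) : ℤ) + (N + 1 : ℕ) ∉ U ∧
        U ∈ family (M + 1) (N + 1) (.zero :: v) (.zero :: w)}
      = PowerSeries.X * t ^ (-(l : ℤ)) • gen t l (M + 1) (N + 1)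
          (family (M + 1) (N + 1) (v ++ [.zero]) (w ++ [.zero])) := by
  have h := gen_of_ne_bullet (M := M) (N := N) (v := v) (w := w) (x := .zero) (z := .zero) ht l 1
    (LinearMap.id : V K l →ₗ[K] V K l) .zero .zero rfl rfl rfl hv (fun U hU h1 h2 => by
      rw [steps_eq_of_letter hU h1 (by simp) (by simp)]
      rfl)
  rw [pow_one, qExt_id] at h
  rw [← h]
  congr 1
  ext U
  constructor
  · rintro ⟨hMN, hU⟩
    obtain ⟨h1, h2⟩ := letter_eq_zero_of_mem_family hU hMN
    exact ⟨h1, h2, hU⟩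
  · rintro ⟨h1, -, hU⟩
    exact ⟨(letter_eq_zero.mp h1).2, hU⟩

/-- Two first letters `0` only say that the new letters are not bullets; membership of the sum of
the lengths decides whether both are `1` or both are `0`. -/
theorem gen_zero_zero (t : K) (l : ℕ) :
    gen t l (M + 1) (N + 1) (family (M + 1) (N + 1) (.zero :: v) (.zero :: w))
      = gen t l (M + 1) (N + 1) {U | ((M + 1 : ℕ) : ℤ) + (N + 1 : ℕ) ∈ U ∧
          U ∈ family (M + 1) (N + 1) (.zero :: v) (.zero :: w)} +
        gen t l (M + 1) (N + 1) {U | ((M + 1 : ℕ) : ℤ) + (N + 1 : ℕ) ∉ U ∧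
          U ∈ family (M + 1) (N + 1) (.zero :: v) (.zero :: w)} := by
  rw [← gen_union M.succ_pos t l (fun U hU => hU.2.1) (fun U hU => hU.2.1)]
  · congr 1
    ext U
    simp only [Set.mem_union, Set.mem_ofPred_eq]
    tauto
  · rw [Set.disjoint_left]
    rintro U ⟨h1, -⟩ ⟨h2, -⟩
    exact h2 h1

/-! ### The initial condition -/

theorem family_replicate_bullet (hM : 0 < M) :
    family M N (List.replicate M .bullet) (List.replicate N .bullet) = {Set.Ici 0} := by
  have hM' : (0 : ℤ) < M := by exact_mod_cast hM
  have hword : ∀ {M N : ℕ} {U : Set ℤ}, (∀ c : ℤ, 0 ≤ c → c ∈ U) →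
      word M N U = List.replicate M .bullet := by
    intro M N U h
    rw [word, List.eq_replicate_iff]
    refine ⟨by simp, fun b hb => ?_⟩
    obtain ⟨i, -, rfl⟩ := List.mem_map.mp hb
    exact letter_eq_bullet.mpr (h _ (by omega))
  ext U
  rw [Set.mem_singleton_iff]
  constructor
  · rintro ⟨hU, hv, -⟩
    ext c
    refine ⟨hU.nonneg c, fun hc => ?_⟩
    have h1 := Int.emod_nonneg c hM'.ne'
    have h2 := Int.emod_lt_of_pos c hM'
    -- The bullets of the first word put every residue modulo `M` into `U`; closure under `M` does
    -- the rest.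
    have h3 : c % M ∈ U := by
      rw [← letter_eq_bullet (N := N)]
      rw [word, List.eq_replicate_iff] at hv
      refine hv.2 _ (List.mem_map.mpr ⟨(c % M).toNat, List.mem_range.mpr (by omega), ?_⟩)
      rw [Int.toNat_of_nonneg h1]
    have := add_mul_mem hU.add_left h3 (Int.ediv_nonneg hc hM'.le)
    rwa [Int.emod_add_mul_ediv] at this
  · rintro rfl
    refine ⟨⟨fun c hc => hc, fun c hc => ?_, fun c hc => ?_, 0, fun c hc => hc⟩,
      hword fun c hc => hc, hword fun c hc => hc⟩ <;>
    · simp only [Set.mem_Ici] at hc ⊢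
      omega

theorem gen_singleton_Ici (t : K) : gen t 0 M N {Set.Ici (0 : ℤ)} = 1 := by
  have harea : areaSet M N (Set.Ici (0 : ℤ)) = ∅ := by
    ext c
    simp only [areaSet, Set.mem_Ici, Set.mem_ofPred_eq, Set.mem_empty_iff_false, iff_false]
    omega
  have hnorth : northSet N (Set.Ici (0 : ℤ)) = ∅ := by
    ext c
    simp only [northSet, Set.mem_Ici, Set.mem_ofPred_eq, Set.mem_empty_iff_false, iff_false]
    omega
  have hpdinv : pdinvSet M N (Set.Ici (0 : ℤ)) = ∅ := by
    ext c
    simp [pdinvSet, hnorth]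
  have hweight : weight t 0 M N (Set.Ici (0 : ℤ)) = 1 := by
    have : steps M N (Set.Ici (0 : ℤ)) = [] := by
      rw [steps, hnorth, sortedList_eq (l := []) List.Pairwise.nil (by simp)]
      rfl
    rw [weight, this, hpdinv, Set.ncard_empty, Nat.cast_zero, neg_zero, zpow_zero, one_smul]
    rfl
  ext1 a
  rw [gen, PowerSeries.coeff_mk, PowerSeries.coeff_one]
  split_ifs with ha
  · have : {U | U ∈ ({Set.Ici (0 : ℤ)} : Set (Set ℤ)) ∧ (areaSet M N U).ncard = a}
        = {Set.Ici (0 : ℤ)} := by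
      ext U
      simp only [Set.mem_singleton_iff, Set.mem_ofPred_eq, and_iff_left_iff_imp]
      rintro rfl
      rw [harea, Set.ncard_empty, ha]
    rw [this, finsum_mem_singleton, hweight]
  · have : {U | U ∈ ({Set.Ici (0 : ℤ)} : Set (Set ℤ)) ∧ (areaSet M N U).ncard = a} = ∅ := by
      ext U
      simp only [Set.mem_singleton_iff, Set.mem_ofPred_eq, Set.mem_empty_iff_false, iff_false,
        not_and]
      rintro rfl
      rw [harea, Set.ncard_empty]
      exact fun h => ha h.symm
    rw [this, finsum_mem_empty]

/-! ### Return to the generating functions of words -/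

theorem L_cons_eq_gen (t : K) (l : ℕ) (x z : Letter) (v w : List Letter) :
    L t l (x :: v) (z :: w) = gen t l (v.length + 1) (w.length + 1)
      (family (v.length + 1) (w.length + 1) (x :: v) (z :: w)) :=
  L_eq_gen (by simp) (by simp) (by simp) (by simp) t l

theorem L_append_eq_gen (t : K) (l : ℕ) (x z : Letter) (v w : List Letter) :
    L t l (v ++ [x]) (w ++ [z]) = gen t l (v.length + 1) (w.length + 1)
      (family (v.length + 1) (w.length + 1) (v ++ [x]) (w ++ [z])) :=
  L_eq_gen (by simp) (by simp) (by simp) (by simp) t l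

/-- `1 - q` has constant coefficient `1`, so it is invertible in the power series over `K`, which
act on those over `A`. -/
theorem eq_inv_one_sub_X_smul {A : Type*} [CommRing A] [Algebra K A] {F G : PowerSeries A}
    (h : F = G + PowerSeries.X * F) : F = (1 - PowerSeries.X : PowerSeries K)⁻¹ • G := by
  have h1 : (1 - PowerSeries.X : PowerSeries K) • F = G := by
    have h2 : algebraMap (PowerSeries K) (PowerSeries A) PowerSeries.X = PowerSeries.X :=
      PowerSeries.map_X _
    rw [sub_smul, one_smul, Algebra.smul_def, h2]
    linear_combination h
  rw [← h1, smul_smul, PowerSeries.inv_mul_cancel _ (by simp), one_smul]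

end

end TorusRec

end

theorem theorem4p1 {K : Type*} [Field K] [CharZero K] (t : K) (ht0 : t ≠ 0) (ht1 : t ≠ 1) :
    -- the sum defining `L(v, w)` has finitely many terms for every power of `q`
    (∀ v w : List Letter, v ≠ [] → w ≠ [] → ∀ a : ℕ,
      {P : PathTuple v.length w.length | Fits v w P ∧ area P = a}.Finite) ∧
    -- `L(•^M, •^N) = 1`
    (∀ M N : ℕ, 0 < M → 0 < N →
      L t 0 (List.replicate M Letter.bullet) (List.replicate N Letter.bullet) = 1) ∧
    -- `L(•v, •w) = L(v•, w•)`
    (∀ (v w : List Letter) (l : ℕ), ones v = l → ones w = l →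
      L t l (Letter.bullet :: v) (Letter.bullet :: w)
        = L t l (v ++ [Letter.bullet]) (w ++ [Letter.bullet])) ∧
    -- `L(0v, 0w) = (1 - q)⁻¹ d_- L(v1, w1)` if `|v| = |w| = 0`
    (∀ v w : List Letter, ones v = 0 → ones w = 0 →
      L t 0 (Letter.zero :: v) (Letter.zero :: w)
        = (1 - PowerSeries.X : PowerSeries K)⁻¹ •
            qExt (dMinus t 0) (L t 1 (v ++ [Letter.one]) (w ++ [Letter.one]))) ∧
    -- `L(0v, 0w) = t^{-l} d_- L(v1, w1) + q t^{-l} L(v0, w0)` if `l = |v| = |w| > 0`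
    (∀ (v w : List Letter) (l : ℕ), 0 < l → ones v = l → ones w = l →
      L t l (Letter.zero :: v) (Letter.zero :: w)
        = t ^ (-(l : ℤ)) •
            qExt (dMinus t l) (L t (l + 1) (v ++ [Letter.one]) (w ++ [Letter.one]))
          + PowerSeries.X * t ^ (-(l : ℤ)) •
            L t l (v ++ [Letter.zero]) (w ++ [Letter.zero])) ∧
    -- `L(1v, 0w) = t^{-l} d_= L(v1, w•)` if `l = |v| = |w| - 1`
    (∀ (v w : List Letter) (l : ℕ), ones v = l → ones w = l + 1 →
      L t (l + 1) (Letter.one :: v) (Letter.zero :: w)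
        = t ^ (-(l : ℤ)) •
            qExt (dEq t l) (L t (l + 1) (v ++ [Letter.one]) (w ++ [Letter.bullet]))) ∧
    -- `L(0v, 1w) = L(v•, w1)`
    (∀ (v w : List Letter) (l : ℕ), ones v = l → ones w + 1 = l →
      L t l (Letter.zero :: v) (Letter.one :: w)
        = L t l (v ++ [Letter.bullet]) (w ++ [Letter.one])) ∧
    -- `L(1v, 1w) = d_+ L(v•, w•)`
    (∀ (v w : List Letter) (l : ℕ), ones v = l → ones w = l →
      L t (l + 1) (Letter.one :: v) (Letter.one :: w)
        = qExt (dPlus t l) (L t l (v ++ [Letter.bullet]) (w ++ [Letter.bullet]))) := by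
  refine ⟨fun v w hv hw a => finite_fits hv hw a, fun M N hM hN => ?_, fun v w l _ _ => ?_,
    fun v w hv hw => ?_, fun v w l _ hv _ => ?_, fun v w l hv _ => ?_, fun v w l _ _ => ?_,
    fun v w l _ _ => ?_⟩
  · rw [L_eq_gen (M := M) (N := N) (by simpa using hM.ne') (by simpa using hN.ne') (by simp)
      (by simp), family_replicate_bullet hM, gen_singleton_Ici]
  · rw [L_cons_eq_gen, L_append_eq_gen, gen_bullet_bullet ht0]
  · apply eq_inv_one_sub_X_smul
    have h := gen_zero_zero_of_add_mem (M := v.length) (N := w.length) (w := w) ht0 0 hv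
    rw [Nat.cast_zero, neg_zero, zpow_zero, one_smul] at h
    rw [L_cons_eq_gen, L_append_eq_gen, ← h,
      ← gen_eq_X_mul_of_ones_eq_zero t v w (by omega) (by omega) hv hw]
    exact gen_zero_zero t 0
  · rw [L_cons_eq_gen, L_append_eq_gen, L_append_eq_gen, gen_zero_zero,
      gen_zero_zero_of_add_mem ht0 l hv, gen_zero_zero_of_add_not_mem ht0 l hv]
  · rw [L_cons_eq_gen, L_append_eq_gen, gen_one_zero ht0 l hv]
  · rw [L_cons_eq_gen, L_append_eq_gen, gen_zero_one ht0]
  · rw [L_cons_eq_gen, L_append_eq_gen, gen_one_one ht0]
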